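/- Let $d\ge 1$ and let $\gamma=\sum_{i=0}^{d-1}g_i|i\rangle\langle i|$ be a full-rank thermal state ($g_i>0$, $\sum_i g_i=1$), $g_{\min}=\min_i g_i$. The control qubit has thermal state $\gamma_C=\mathbb 1/2$; composite systems have the product of the thermal states as thermal state; $A$, $B$ are $d$-dimensional with thermal state $\gamma$, and $C'$ is a copy of the control qubit $C$. Write $X\le Y$ if $Y-X$ is positive semidefinite (operators) or completely positive (maps). For a Hermitian operator $X$ on a system with thermal state $\gamma_X$ put $R_{\mathrm T}(X)=\min\{r: X\le(1+r)\gamma_X\}$. For a channel $\Lambda$ from a system with thermal state $\gamma_{\rm in}$ to one with thermal state $\gamma_{\rm out}$ put $$R_{\mathrm T}(\Lambda)=\min\{r:\Lambda\le(1+r)F,\ F \text{ a channel},\ F(\gamma_{\rm in})=\gamma_{\rm out}\},$$ $$R_{\mathrm S}(\Lambda)=\min\{r:\Lambda\le(1+r)\,\mathrm{Tr}\{\cdot\}\sigma,\ \sigma\text{ a state}\},\qquad R(\Lambda\|\Gamma)=\min\{r:\Lambda\le(1+r)\,\mathrm{Tr}\{\cdot\}\gamma_{\rm out}\},$$ and $P_{\mathrm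 T}(F)=R(F\|\Gamma)$ if $F$ is Gibbs-preserving, i.e. $F(\gamma_{\rm in})=\gamma_{\rm out}$. For $s\in[0,1]$ let $G=s\Gamma+(1-s)\mathcal I$ on the $d$-dimensional system, with $\Gamma(\cdot)=\mathrm{Tr}\{\cdot\}\gamma$, and let $(K_m)_{m=1}^{N}$ be its Kraus representation formed by the nonzero operators among $\sqrt{s\,g_j}\,|j\rangle\langle i|$ $(0\le i,j\le d-1)$ and $\sqrt{1-s}\,\mathbb 1$ (so $N=d^2+1$ for $0<s<1$, $N=d^2$ for $s=1$, $N=1$ for $s=0$). The coherent control $\mathcal C[G,G]$ is the channel with Kraus operators $C_{mn}=N^{-1/2}\left(|0\rangle\langle 0|\otimes K_m+|1\rangle\langle 1|\otimes K_n\right)$, $1\le m,n\le N$. For $\alpha\in[0,1]$ and $\varphi\in\mathbb R$ let $\rho_C=|\psi\rangle\langle\psi|$ with $|\psi\rangle=\sqrt\alpha\,|0\rangle+e^{i\varphi}\sqrt{1-\alpha}\,|1\rangle$, and $\Lambda_{\mathcal C}(\cdot)=\mathcal C[G,G](\rho_C\otimes\cdot)$, a channel from $A$ to $BC'$. Finally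 put $$f(\gamma)=\frac{1+R_{\mathrm T}(\chi)}{d^2+1},\qquad \chi=\left(e^{-i\varphi}|0\rangle\langle1|+e^{i\varphi}|1\rangle\langle0|\right)\otimes\left(|\hat\gamma\rangle\langle\tilde\gamma|+|\tilde\gamma\rangle\langle\hat\gamma|\right),$$ where $|\hat\gamma\rangle=\sum_{k,l}\sqrt{g_kg_l}\,|k\rangle|l\rangle$, $|\tilde\gamma\rangle=\sum_i\sqrt{g_i}\,|i\rangle|i\rangle$, and $R_{\mathrm T}(\chi)$ is taken with respect to $\gamma_C\otimes\gamma\otimes\gamma$. Then all minima above for $\chi$, $\rho_C$, $G$ and $\Lambda_{\mathcal C}$ (that is, for $R_{\mathrm T}(\chi)$, $R_{\mathrm T}(\rho_C)$, $P_{\mathrm T}(G)$, $R(\Lambda_{\mathcal C}\|\Gamma)$, $R_{\mathrm T}(\Lambda_{\mathcal C})$ and $R_{\mathrm S}(\Lambda_{\mathcal C})$) are attained; $f(\gamma)>0$, and $f(\gamma)$ does not depend on $\varphi$; $R_{\mathrm T}(\rho_C)=1$; and for all $s,\alpha\in[0,1]$ and $\varphi\in\mathbb R$, $$R(\Lambda_{\mathcal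 C}\|\Gamma)\le R_{\mathrm T}(\rho_C)+2P_{\mathrm T}(G)+\sqrt{\alpha(1-\alpha)s(1-s)}\,f(\gamma),$$ with equality if $s=0$ or $s=1$, and $$R(\Lambda_{\mathcal C}\|\Gamma)\ \ge\ R_{\mathrm S}(\Lambda_{\mathcal C})\ \ge\ \frac{g_{\min}^4}{2}\left[R(\Lambda_{\mathcal C}\|\Gamma)-R_{\mathrm T}(\Lambda_{\mathcal C})\right]^2 .$$ If $s=1$, then $R_{\mathrm T}(\Lambda_{\mathcal C})=\sqrt{(1-2\alpha)^2+4d^{-2}\alpha(1-\alpha)}$. -/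

import Mathlib

open scoped Kronecker ComplexOrder

noncomputable section

namespace CoherentControl

/-! ### States, channels and the order on them

A finite-dimensional system is described by a finite index type labelling its energy eigenbasis;
operators are complex matrices in that basis. -/

/-- Operators on the system labelled by `n`. -/
abbrev Op (n : Type) : Type := Matrix n n ℂ

/-- Linear maps from operators on `n` to operators on `m`. -/
abbrev SuperOp (n m : Type) : Type := Op n →ₗ[ℂ] Op m

/-- Density operators: positive semidefinite with unit trace. -/
def IsState {n : Type} [Fintype n] (ρ : Op n) : Prop :=
  ρ.PosSemidef ∧ ρ.trace = 1

/-- `(id_k ⊗ Φ) X`, where `X` is a `k × k` block matrix with blocks in `Op n`. -/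
def ampliation {n m : Type} (k : ℕ) (Φ : SuperOp n m) (X : Op (Fin k × n)) : Op (Fin k × m) :=
  Matrix.of fun p q => Φ (Matrix.of fun i j => X (p.1, i) (q.1, j)) p.2 q.2

/-- Complete positivity: every ampliation `id_k ⊗ Φ` preserves positive semidefiniteness. -/
def IsCP {n m : Type} (Φ : SuperOp n m) : Prop :=
  ∀ (k : ℕ) (X : Op (Fin k × n)), X.PosSemidef → (ampliation k Φ X).PosSemidef

/-- Quantum channels: completely positive trace-preserving maps. -/
def IsChannel {n m : Type} [Fintype n] [Fintype m] (Φ : SuperOp n m) : Prop :=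
  IsCP Φ ∧ ∀ X : Op n, (Φ X).trace = X.trace

/-- The order on operators: `X ≤ Y` iff `Y - X` is positive semidefinite. -/
def OpLE {n : Type} (X Y : Op n) : Prop := (Y - X).PosSemidef

/-- The order on maps: `Λ ≤ Ω` iff `Ω - Λ` is completely positive. -/
def MapLE {n m : Type} (Λ Ω : SuperOp n m) : Prop := IsCP (Ω - Λ)

/-- The trace-and-replace map `X ↦ Tr(X) σ`. -/
def traceReplace (n : Type) {m : Type} [Fintype n] (σ : Op m) : SuperOp n m :=
  (Matrix.traceLinearMap n ℂ ℂ).smulRight σ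

/-- Gibbs-preserving operations with respect to the thermal states `γA` and `γB`. -/
def GPO {n m : Type} [Fintype n] [Fintype m] (γA : Op n) (γB : Op m) : Set (SuperOp n m) :=
  {G | IsChannel G ∧ G γA = γB}

/-- Non-signalling operations: trace-and-replace channels. -/
def NSO (n m : Type) [Fintype n] [Fintype m] : Set (SuperOp n m) :=
  {Φ | ∃ σ : Op m, IsState σ ∧ Φ = traceReplace n σ}

/-! ### Robustness measures -/

/-- The numbers `s` over which the robustness of an operator relative to `γ` is minimised. -/
def opFeasible {n : Type} (γ X : Op n) : Set ℝ :=
  {s | OpLE X ((1 + s) • γ)}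

/-- The numbers `s` over which the robustness of a map relative to the free set `F` is
minimised. -/
def mapFeasible {n m : Type} (F : Set (SuperOp n m)) (Λ : SuperOp n m) : Set ℝ :=
  {s | ∃ Z ∈ F, MapLE Λ ((1 + s) • Z)}

/-- `R_T(X) = min {s | X ≤ (1 + s) γ}` (static robustness of athermality). -/
def RTop {n : Type} (γ X : Op n) : ℝ := sInf (opFeasible γ X)

/-- `R_T(Λ) = min {s | Λ ≤ (1 + s) G, G Gibbs-preserving}` (dynamical robustness of
athermality). -/
def RT {n m : Type} [Fintype n] [Fintype m] (γA : Op n) (γB : Op m) (Λ : SuperOp n m) : ℝ :=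
  sInf (mapFeasible (GPO γA γB) Λ)

/-- `R_S(Λ) = min {s | Λ ≤ (1 + s) Φ, Φ non-signalling}` (robustness of signalling). -/
def RS {n m : Type} [Fintype n] [Fintype m] (Λ : SuperOp n m) : ℝ :=
  sInf (mapFeasible (NSO n m) Λ)

/-- `R(Λ‖Γ) = min {s | Λ ≤ (1 + s) Γ}`, where `Γ(X) = Tr(X) γB` (joint robustness).
For a Gibbs-preserving `Λ` this is its athermality preservability `P_T(Λ)`. -/
def R {n m : Type} [Fintype n] (γB : Op m) (Λ : SuperOp n m) : ℝ :=
  sInf (mapFeasible {traceReplace n γB} Λ)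

/-! ### Kraus families and coherent control -/

/-- The map `X ↦ ∑ₖ Kₖ X Kₖ†`. -/
def krausMap {κ n m : Type} [Fintype κ] [Fintype n]
    (K : κ → Matrix m n ℂ) : SuperOp n m where
  toFun X := ∑ k, K k * X * (K k).conjTranspose
  map_add' X Y := by
    simp [Matrix.mul_add, Matrix.add_mul, Finset.sum_add_distrib]
  map_smul' c X := by
    simp [Finset.smul_sum]

/-- The Kraus operators
`C_{pq} = N^{-1/2} (|0⟩⟨0| ⊗ K_p + |1⟩⟨1| ⊗ K_q)` of the coherent control of two copies of
the channel with the Kraus family `K`, where `N` is the number of members of `K`. -/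
def controlKraus {κ n : Type} [Fintype κ] (K : κ → Op n) (pq : κ × κ) : Op (Fin 2 × n) :=
  (((Real.sqrt (Fintype.card κ))⁻¹ : ℝ) : ℂ) •
    (Matrix.single (0 : Fin 2) (0 : Fin 2) (1 : ℂ) ⊗ₖ K pq.1 +
      Matrix.single (1 : Fin 2) (1 : Fin 2) (1 : ℂ) ⊗ₖ K pq.2)

/-- The map `X ↦ 𝒞[K, K](ρC ⊗ X)` induced by a control state `ρC`. -/
def controlled {κ n : Type} [Fintype κ] [Fintype n] (K : κ → Op n) (ρC : Op (Fin 2)) :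
    SuperOp n (Fin 2 × n) where
  toFun X := krausMap (controlKraus K) (ρC ⊗ₖ X)
  map_add' X Y := by
    rw [Matrix.kronecker_add, map_add]
  map_smul' c X := by
    rw [Matrix.kronecker_smul, map_smul, RingHom.id_apply]

/-! ### The concrete objects -/

variable {d : ℕ}

/-- The thermal state with populations `g`, in its energy eigenbasis. -/
def thermal (g : Fin d → ℝ) : Op (Fin d) := Matrix.diagonal fun i => (g i : ℂ)

/-- The thermal state `𝟙/2` of the control qubit. -/
def thermalC : Op (Fin 2) := (1 / 2 : ℂ) • 1

/-- The thermal state of the output system, composed of the control qubit and the target. -/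
def thermalOut (g : Fin d → ℝ) : Op (Fin 2 × Fin d) := thermalC ⊗ₖ thermal g

/-- The completely thermalising channel `Γ`. -/
def Gam (g : Fin d → ℝ) : SuperOp (Fin d) (Fin d) := traceReplace (Fin d) (thermal g)

/-- `G = s Γ + (1 - s) id`. -/
def G (g : Fin d → ℝ) (s : ℝ) : SuperOp (Fin d) (Fin d) :=
  s • Gam g + (1 - s) • LinearMap.id

/-- The pure control state `|ψ⟩⟨ψ|` with `|ψ⟩ = √α |0⟩ + e^{iφ} √(1-α) |1⟩`. -/
def controlState (α φ : ℝ) : Op (Fin 2) :=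
  let ψ : Fin 2 → ℂ :=
    ![(Real.sqrt α : ℂ), Complex.exp (Complex.I * φ) * (Real.sqrt (1 - α) : ℂ)]
  Matrix.vecMulVec ψ (star ψ)

/-- The operators `√s √g_j |j⟩⟨i|` (at `some (i, j)`) and `√(1-s) 𝟙` (at `none`). -/
def allKraus (g : Fin d → ℝ) (s : ℝ) : Option (Fin d × Fin d) → Op (Fin d)
  | some (i, j) => Matrix.single j i ((Real.sqrt s * Real.sqrt (g j) : ℝ) : ℂ)
  | none => (Real.sqrt (1 - s) : ℂ) • 1

/-- The Kraus family of `G`: the nonzero operators among `allKraus g s`. If all `g_j > 0`, it has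
`d² + 1` members for `0 < s < 1`, the `d²` members `√g_j |j⟩⟨i|` for `s = 1`, and the single
member `𝟙` for `s = 0`. -/
def krausG (g : Fin d → ℝ) (s : ℝ) :
    {x : Option (Fin d × Fin d) // allKraus g s x ≠ 0} → Op (Fin d) :=
  fun x => allKraus g s x.1

open Classical in
/-- The channel `Λ_C = 𝒞[G, G](ρC ⊗ ·)` from the target to the control qubit and the target. -/
def LamC (g : Fin d → ℝ) (s α φ : ℝ) : SuperOp (Fin d) (Fin 2 × Fin d) :=
  controlled (krausG g s) (controlState α φ)

open Classical in
/-- `krausG g s` is indeed a Kraus family of `G`. -/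
theorem krausMap_krausG (g : Fin d → ℝ) (hg : ∀ i, 0 < g i) (s : ℝ) (hs0 : 0 ≤ s)
    (hs1 : s ≤ 1) : krausMap (krausG g s) = G g s := by
  ext1 X
  have h1 : krausMap (krausG g s) X = krausMap (allKraus g s) X := by
    simp only [krausMap, LinearMap.coe_mk, AddHom.coe_mk, krausG]
    rw [← Finset.sum_subtype (p := fun x => allKraus g s x ≠ 0)
      (Finset.univ.filter fun x => allKraus g s x ≠ 0) (by simp)
      (fun k => allKraus g s k * X * (allKraus g s k).conjTranspose)]
    refine Finset.sum_subset (Finset.filter_subset _ _) fun x _ hx => ?_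
    have hx0 : allKraus g s x = 0 := by simpa using hx
    simp [hx0]
  have h2 : ∀ i j : Fin d, allKraus g s (some (i, j)) * X *
      (allKraus g s (some (i, j))).conjTranspose =
        Matrix.single j j ((s : ℂ) * (g j : ℂ) * X i i) := by
    intro i j
    have hc : (Real.sqrt s * Real.sqrt (g j)) * (Real.sqrt s * Real.sqrt (g j)) = s * g j := by
      rw [mul_mul_mul_comm, Real.mul_self_sqrt hs0, Real.mul_self_sqrt (hg j).le]
    simp only [allKraus, Matrix.conjTranspose_single, Matrix.single_mul_mul_single]
    congr 1
    rw [Complex.star_def, Complex.conj_ofReal, mul_right_comm, ← Complex.ofReal_mul, hc,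
      Complex.ofReal_mul]
  have h3 : allKraus g s none * X * (allKraus g s none).conjTranspose =
      ((1 - s : ℝ) : ℂ) • X := by
    simp only [allKraus, Matrix.conjTranspose_smul, Matrix.conjTranspose_one, Matrix.smul_mul,
      Matrix.mul_smul, Matrix.one_mul, Matrix.mul_one, smul_smul, Complex.star_def,
      Complex.conj_ofReal]
    rw [← Complex.ofReal_mul, Real.mul_self_sqrt (by linarith)]
  rw [h1]
  simp only [krausMap, LinearMap.coe_mk, AddHom.coe_mk, Fintype.sum_option,
    Fintype.sum_prod_type, h2, h3]
  ext a b
  by_cases hab : a = b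
  · subst hab
    simp [G, Gam, traceReplace, thermal, Matrix.sum_apply, Matrix.single_apply, Matrix.trace,
      Finset.sum_mul, Finset.mul_sum]
    rw [add_comm]
    congr 1
    exact Finset.sum_congr rfl fun i _ => by ring
  · simp [G, Gam, traceReplace, thermal, Matrix.sum_apply, Matrix.single_apply, hab]
    refine Finset.sum_eq_zero fun c _ => Finset.sum_eq_zero fun e _ => if_neg ?_
    rintro ⟨rfl, h⟩
    exact hab h

/-- `|γ̂⟩⟩ = ∑_{kl} √g_k √g_l |k⟩|l⟩`. -/
def hatVec (g : Fin d → ℝ) : Fin d × Fin d → ℂ :=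
  fun p => ((Real.sqrt (g p.1) * Real.sqrt (g p.2) : ℝ) : ℂ)

/-- The thermofield double vector `|γ̃⟩ = ∑_i √g_i |i⟩|i⟩`. -/
def tfdVec (g : Fin d → ℝ) : Fin d × Fin d → ℂ :=
  fun p => if p.1 = p.2 then (Real.sqrt (g p.1) : ℂ) else 0

/-- `τ = |γ̂⟩⟩⟨γ̃| + |γ̃⟩⟨⟨γ̂|`. -/
def tau (g : Fin d → ℝ) : Op (Fin d × Fin d) :=
  Matrix.vecMulVec (hatVec g) (star (tfdVec g)) + Matrix.vecMulVec (tfdVec g) (star (hatVec g))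

/-- `χ = (e^{-iφ} |0⟩⟨1| + e^{iφ} |1⟩⟨0|) ⊗ τ`. -/
def chi (g : Fin d → ℝ) (φ : ℝ) : Op (Fin 2 × (Fin d × Fin d)) :=
  (Matrix.single (0 : Fin 2) (1 : Fin 2) (Complex.exp (-(Complex.I * φ))) +
    Matrix.single (1 : Fin 2) (0 : Fin 2) (Complex.exp (Complex.I * φ))) ⊗ₖ tau g

/-- The thermal state `γ_C ⊗ γ ⊗ γ` relative to which `χ` is measured. -/
def thermalChi (g : Fin d → ℝ) : Op (Fin 2 × (Fin d × Fin d)) :=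
  thermalC ⊗ₖ (thermal g ⊗ₖ thermal g)

/-- `f(γ) = (1 + R_T(χ)) / (d² + 1)`, with `χ` taken at phase `0`. -/
def fCoeff (g : Fin d → ℝ) : ℝ :=
  (1 + RTop (thermalChi g) (chi g 0)) / ((d : ℝ) ^ 2 + 1)

end CoherentControl

end

open scoped Kronecker ComplexOrder

noncomputable section

namespace CoherentControl

/-! ### Positive semidefinite matrices -/

section PosSemidef

variable {n : Type} [Fintype n]

/-! By Choi's criterion, `R` of `LamC` is the least r with (1+r)/2 · 𝟙 ⊗ W ≥ J. Here W = 𝟙 ⊗ γ is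
diagonal and, with the control in front, J = diag(α, 1-α) ⊗ (sW + (1-s)ΩΩ†) + N⁻¹√(α(1-α)) F ⊗ vv†
(`choi_LamC`). F is `phaseFlip`, Ω is `maxEntVec`, a is `sqrtVec`, and v = √s a + √(1-s) Ω. Two
facts control such matrices: vv† ≤ tW is governed by ∑|v_i|²/w_i ≤ t (Cauchy–Schwarz), and diag(p,q)
+ cF ≥ 0 means p, q ≥ 0 and c² ≤ pq.

For the upper bound, expand vv† (`upper_mem_opFeasible`). With z = ∑ 1/g_i, the aa† part costs s,
the ΩΩ† part costs (1-s)z, and the cross terms are χ rescaled by γ^(-1/2), which is what f(γ)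
measures. Since P_T(G) = (1-s)(z-1), the costs add up to the claim. At s = 0 and s = 1 a single
vector survives in v; compressing the target with W⁻¹v leaves a qubit matrix whose determinant gives
the matching lower bound.

For a channel, R_T(Λ) is the static robustness of Λ(γ) (`mapFeasible_GPO`); at s = 1 this is again a
qubit problem. Finally, if Λ ≤ (1+r) Tr(·)σ, then (1+r)σ - Λ(γ) is positive with trace r, hence at
most (2r/g_min) γ_out. So R ≤ R_T + 2R_S/g_min (`add_div_mem_mapFeasible`), and the a priori bound R
≤ 2d/g_min - 1 turns this linear estimate into the quadratic one. -/

/-- A real diagonal matrix. -/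
def realDiag [DecidableEq n] (w : n → ℝ) : Op n := Matrix.diagonal fun i => (w i : ℂ)

theorem dotProduct_realDiag_mulVec [DecidableEq n] (w : n → ℝ) (x : n → ℂ) :
    star x ⬝ᵥ (realDiag w).mulVec x = ((∑ i, w i * ‖x i‖ ^ 2 : ℝ) : ℂ) := by
  simp only [dotProduct, realDiag, Matrix.mulVec_diagonal, Pi.star_apply, Complex.ofReal_sum]
  refine Finset.sum_congr rfl fun i _ => ?_
  have := Complex.conj_mul' (x i)
  push_cast
  rw [← this, Complex.star_def]
  ring

theorem dotProduct_vecMulVec_mulVec (v x : n → ℂ) :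
    star x ⬝ᵥ (Matrix.vecMulVec v (star v)).mulVec x = ((‖star v ⬝ᵥ x‖ ^ 2 : ℝ) : ℂ) := by
  rw [Matrix.vecMulVec_mulVec, dotProduct_smul]
  have h : star x ⬝ᵥ v = star (star v ⬝ᵥ x) := by
    rw [← Matrix.star_dotProduct_star, star_star, dotProduct_comm]
  rw [h, op_smul_eq_smul, smul_eq_mul, Complex.star_def, Complex.mul_conj']
  push_cast
  rfl

omit [Fintype n] in
theorem isHermitian_realDiag [DecidableEq n] (w : n → ℝ) : (realDiag w).IsHermitian := by
  refine Matrix.isHermitian_diagonal_of_self_adjoint _ ?_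
  ext i
  simp

/-- Weighted Cauchy–Schwarz: |⟨v,x⟩|² ≤ (∑ |v_i|²/w_i)(∑ w_i|x_i|²). -/
theorem posSemidef_smul_realDiag_sub_vecMulVec [DecidableEq n] {w : n → ℝ} (hw : ∀ i, 0 < w i)
    {v : n → ℂ} {t : ℝ} (ht : ∑ i, ‖v i‖ ^ 2 / w i ≤ t) :
    (t • realDiag w - Matrix.vecMulVec v (star v)).PosSemidef := by
  refine .of_dotProduct_mulVec_nonneg
    (((isHermitian_realDiag w).smul (IsSelfAdjoint.all t)).sub
      (Matrix.posSemidef_vecMulVec_self_star v).1) fun x => ?_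
  rw [Matrix.sub_mulVec, dotProduct_sub, Matrix.smul_mulVec, dotProduct_smul,
    dotProduct_realDiag_mulVec, dotProduct_vecMulVec_mulVec, Complex.real_smul,
    ← Complex.ofReal_mul, ← Complex.ofReal_sub, Complex.zero_le_real, sub_nonneg]
  have h1 : ‖star v ⬝ᵥ x‖ ≤ ∑ i, ‖v i‖ * ‖x i‖ := by
    refine (norm_sum_le _ _).trans (Finset.sum_le_sum fun i _ => ?_)
    simp
  have h2 : (∑ i, ‖v i‖ * ‖x i‖) ^ 2 ≤ (∑ i, ‖v i‖ ^ 2 / w i) * ∑ i, w i * ‖x i‖ ^ 2 := by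
    refine Finset.sum_sq_le_sum_mul_sum_of_sq_le_mul _ (fun i _ => ?_) (fun i _ => ?_)
      fun i _ => le_of_eq ?_
    · have := hw i; positivity
    · have := hw i; positivity
    · have := (hw i).ne'; field_simp
  refine (pow_le_pow_left₀ (norm_nonneg _) h1 2).trans (h2.trans ?_)
  refine mul_le_mul_of_nonneg_right ht (Finset.sum_nonneg fun i _ => ?_)
  have := hw i; positivity

/-- W⁻¹v is the equality case of that Cauchy–Schwarz inequality, hence the test vector in the
optimality proofs for `G` and for `LamC` at s = 0, 1. -/
theorem dotProduct_realDiag_mulVec_div [DecidableEq n] {w : n → ℝ} (hw : ∀ i, 0 < w i)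
    (v : n → ℂ) : star (fun i => v i / (w i : ℂ)) ⬝ᵥ (realDiag w).mulVec (fun i => v i / (w i : ℂ)) =
      ((∑ i, ‖v i‖ ^ 2 / w i : ℝ) : ℂ) := by
  rw [dotProduct_realDiag_mulVec]
  congr 1
  refine Finset.sum_congr rfl fun i _ => ?_
  have := (hw i).ne'
  rw [norm_div, Complex.norm_real, Real.norm_of_nonneg (hw i).le]
  field_simp

theorem dotProduct_vecMulVec_mulVec_div {w : n → ℝ} (hw : ∀ i, 0 < w i) (v : n → ℂ) :
    star (fun i => v i / (w i : ℂ)) ⬝ᵥ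
      (Matrix.vecMulVec v (star v)).mulVec (fun i => v i / (w i : ℂ)) =
      (((∑ i, ‖v i‖ ^ 2 / w i) ^ 2 : ℝ) : ℂ) := by
  have h : (star v ⬝ᵥ fun i => v i / (w i : ℂ)) = ((∑ i, ‖v i‖ ^ 2 / w i : ℝ) : ℂ) := by
    rw [dotProduct, Complex.ofReal_sum]
    refine Finset.sum_congr rfl fun i _ => ?_
    rw [Pi.star_apply, Complex.star_def, ← mul_div_assoc, Complex.conj_mul']
    push_cast
    rfl
  rw [dotProduct_vecMulVec_mulVec, h, Complex.norm_real, Real.norm_of_nonneg]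
  refine Finset.sum_nonneg fun i _ => ?_
  have := hw i
  positivity

theorem sum_le_of_posSemidef_smul_realDiag_sub_vecMulVec [DecidableEq n] {w : n → ℝ}
    (hw : ∀ i, 0 < w i) {v : n → ℂ} {t : ℝ} (hv : 0 < ∑ i, ‖v i‖ ^ 2 / w i)
    (h : (t • realDiag w - Matrix.vecMulVec v (star v)).PosSemidef) :
    ∑ i, ‖v i‖ ^ 2 / w i ≤ t := by
  have hx := h.dotProduct_mulVec_nonneg fun i => v i / w i
  rw [Matrix.sub_mulVec, dotProduct_sub, Matrix.smul_mulVec, dotProduct_smul,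
    dotProduct_realDiag_mulVec_div hw, dotProduct_vecMulVec_mulVec_div hw, Complex.real_smul,
    ← Complex.ofReal_mul, ← Complex.ofReal_sub, Complex.zero_le_real, sub_nonneg, sq] at hx
  exact le_of_mul_le_mul_right hx hv

theorem exists_eq_sum_vecMulVec {M : Op n} (hM : M.PosSemidef) :
    ∃ v : n → n → ℂ, M = ∑ c, Matrix.vecMulVec (v c) (star (v c)) := by
  classical
  open scoped MatrixOrder in
  obtain ⟨B, rfl⟩ := CStarAlgebra.nonneg_iff_eq_star_mul_self.mp hM.nonneg
  refine ⟨fun c i => star (B c i), ?_⟩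
  ext i j
  simp [Matrix.mul_apply, Matrix.sum_apply, Matrix.vecMulVec_apply, Matrix.star_apply]

theorem trace_re_sum_vecMulVec (v : n → n → ℂ) :
    (∑ c, Matrix.vecMulVec (v c) (star (v c))).trace.re = ∑ c, ∑ i, ‖v c i‖ ^ 2 := by
  rw [Matrix.trace_sum, Complex.re_sum]
  refine Finset.sum_congr rfl fun c _ => ?_
  rw [Matrix.trace, Complex.re_sum]
  refine Finset.sum_congr rfl fun i _ => ?_
  rw [Matrix.diag_apply, Matrix.vecMulVec_apply, Pi.star_apply, Complex.star_def,
    Complex.mul_conj', ← Complex.ofReal_pow, Complex.ofReal_re]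

/-- Split M into rank-one terms; each costs ∑ |v_i|²/w_i ≤ ‖v‖²/m, and these costs total at most Tr
M / m. -/
theorem posSemidef_smul_realDiag_sub [DecidableEq n] {M : Op n} (hM : M.PosSemidef) {w : n → ℝ}
    {m t : ℝ} (hm : 0 < m) (hw : ∀ i, m ≤ w i) (ht : M.trace.re ≤ t * m) :
    (t • realDiag w - M).PosSemidef := by
  obtain ⟨v, hv⟩ := exists_eq_sum_vecMulVec hM
  have hw' : ∀ i, 0 < w i := fun i => hm.trans_le (hw i)
  have htr : M.trace.re = ∑ c, ∑ i, ‖v c i‖ ^ 2 := by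
    rw [hv, trace_re_sum_vecMulVec]
  have hD : (realDiag w).PosSemidef :=
    Matrix.PosSemidef.diagonal fun i => by simpa using (hw' i).le
  have hsum : (∑ c, ((∑ i, ‖v c i‖ ^ 2 / w i) • realDiag w
      - Matrix.vecMulVec (v c) (star (v c)))).PosSemidef :=
    Matrix.posSemidef_sum _ fun c _ => posSemidef_smul_realDiag_sub_vecMulVec hw' le_rfl
  have hle : ∑ c, ∑ i, ‖v c i‖ ^ 2 / w i ≤ t := by
    have h1 : (∑ c, ∑ i, ‖v c i‖ ^ 2 / w i) ≤ (∑ c, ∑ i, ‖v c i‖ ^ 2) / m := by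
      simp only [Finset.sum_div]
      refine Finset.sum_le_sum fun c _ => Finset.sum_le_sum fun i _ => ?_
      exact div_le_div_of_nonneg_left (by positivity) hm (hw i)
    rw [← htr] at h1
    exact h1.trans ((div_le_iff₀ hm).2 ht)
  have heq : t • realDiag w - M = (t - ∑ c, ∑ i, ‖v c i‖ ^ 2 / w i) • realDiag w
      + ∑ c, ((∑ i, ‖v c i‖ ^ 2 / w i) • realDiag w
        - Matrix.vecMulVec (v c) (star (v c))) := by
    rw [Finset.sum_sub_distrib, ← hv, ← Finset.sum_smul]
    module
  rw [heq]
  exact (hD.smul (sub_nonneg.2 hle)).add hsum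

theorem isClosed_posSemidef : IsClosed {M : Op n | M.PosSemidef} := by
  have : {M : Op n | M.PosSemidef} =
      {M | M.conjTranspose = M} ∩ ⋂ x : n → ℂ, {M | 0 ≤ star x ⬝ᵥ M.mulVec x} := by
    ext M
    simp [Matrix.posSemidef_iff_dotProduct_mulVec, Matrix.IsHermitian]
  rw [this]
  refine (isClosed_eq (by fun_prop) continuous_id).inter (isClosed_iInter fun x => ?_)
  refine isClosed_le continuous_const ?_
  exact Continuous.dotProduct continuous_const (Continuous.matrix_mulVec continuous_id continuous_const)

omit [Fintype n] in
theorem posSemidef_of_eq {A B : Op n} (hA : A.PosSemidef) (h : B = A) : B.PosSemidef := h ▸ hA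

/-- The difference telescopes as P ⊗ (M - M') + (P - Q) ⊗ M'. Q may be indefinite, as it is for
multiples of `phaseFlip`. -/
theorem posSemidef_kronecker_sub_kronecker {m : Type} [Fintype m] {P Q : Op m} {M M' : Op n}
    (hP : P.PosSemidef) (hPQ : (P - Q).PosSemidef) (hM' : M'.PosSemidef)
    (hM : (M - M').PosSemidef) : (P ⊗ₖ M - Q ⊗ₖ M').PosSemidef := by
  have h : P ⊗ₖ M - Q ⊗ₖ M' = P ⊗ₖ (M - M') + (P - Q) ⊗ₖ M' := by
    ext ⟨i, k⟩ ⟨j, l⟩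
    simp only [Matrix.sub_apply, Matrix.add_apply, Matrix.kroneckerMap_apply]
    ring
  rw [h]
  exact (hP.kronecker hM).add (hPQ.kronecker hM')

theorem norm_apply_le_one {M : Op n} (hM : M.PosSemidef) (htr : M.trace = 1) (i j : n) :
    ‖M i j‖ ≤ 1 := by
  obtain ⟨v, hv⟩ := exists_eq_sum_vecMulVec hM
  have h1 : ∑ c, ∑ i, ‖v c i‖ ^ 2 = 1 := by
    rw [← trace_re_sum_vecMulVec, ← hv, htr, Complex.one_re]
  rw [hv, Matrix.sum_apply, ← h1]
  refine (norm_sum_le _ _).trans (Finset.sum_le_sum fun c _ => ?_)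
  rw [Matrix.vecMulVec_apply, norm_mul, Pi.star_apply, norm_star]
  have hi := Finset.single_le_sum (f := fun i => ‖v c i‖ ^ 2) (fun i _ => sq_nonneg _)
    (Finset.mem_univ i)
  have hj := Finset.single_le_sum (f := fun i => ‖v c i‖ ^ 2) (fun i _ => sq_nonneg _)
    (Finset.mem_univ j)
  nlinarith [sq_nonneg (‖v c i‖ - ‖v c j‖)]

end PosSemidef

/-! ### Complete positivity and the Choi matrix -/

section Choi

/-- Sandwiching by u ⊗ 𝟙. With u constant 1 it performs the contraction in Choi's theorem; with u a
test vector it isolates the control qubit. -/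
theorem posSemidef_compress {ι n : Type} [Fintype ι] [Fintype n] {M : Op (ι × n)}
    (hM : M.PosSemidef) (u : ι → ℂ) :
    (Matrix.of fun x y => ∑ i, ∑ j, star (u i) * M (i, x) (j, y) * u j : Op n).PosSemidef := by
  classical
  let B : Matrix (ι × n) n ℂ := Matrix.of fun p y => if p.2 = y then u p.1 else 0
  have h : (Matrix.of fun x y => ∑ i, ∑ j, star (u i) * M (i, x) (j, y) * u j : Op n) =
      B.conjTranspose * M * B := by
    ext x y
    simp [B, Matrix.mul_apply, Fintype.sum_prod_type, apply_ite, Finset.sum_mul]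
    exact Finset.sum_comm
  rw [h]
  exact hM.conjTranspose_mul_mul_same B

variable {d : ℕ} {m : Type}

/-- The Choi matrix `∑ |i⟩⟨j| ⊗ Φ(|i⟩⟨j|)`. -/
def choi (Φ : SuperOp (Fin d) m) : Op (Fin d × m) :=
  Matrix.of fun p q => Φ (Matrix.single p.1 q.1 1) p.2 q.2

theorem choi_apply (Φ : SuperOp (Fin d) m) (p q : Fin d × m) :
    choi Φ p q = Φ (Matrix.single p.1 q.1 1) p.2 q.2 := rfl

theorem choi_sub (Φ Ψ : SuperOp (Fin d) m) : choi (Φ - Ψ) = choi Φ - choi Ψ := rfl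

theorem choi_add (Φ Ψ : SuperOp (Fin d) m) : choi (Φ + Ψ) = choi Φ + choi Ψ := rfl

theorem choi_smul (c : ℝ) (Φ : SuperOp (Fin d) m) : choi (c • Φ) = c • choi Φ := rfl

theorem apply_eq_sum_choi (Φ : SuperOp (Fin d) m) (X : Op (Fin d)) (a b : m) :
    Φ X a b = ∑ i, ∑ j, X i j * choi Φ (i, a) (j, b) := by
  conv_lhs => rw [Matrix.matrix_eq_sum_single X]
  simp only [map_sum, Matrix.sum_apply, choi_apply]
  refine Finset.sum_congr rfl fun i _ => Finset.sum_congr rfl fun j _ => ?_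
  rw [← mul_one (X i j), ← smul_eq_mul, ← Matrix.smul_single, map_smul]
  simp

theorem isCP_iff_posSemidef_choi [Fintype m] (Φ : SuperOp (Fin d) m) :
    IsCP Φ ↔ (choi Φ).PosSemidef := by
  constructor
  · intro h
    -- The ampliation at k = d sends the projector onto the maximally entangled vector to the Choi
    -- matrix.
    have := h d _ (Matrix.posSemidef_vecMulVec_self_star
      fun p : Fin d × Fin d => if p.1 = p.2 then (1 : ℂ) else 0)
    convert this using 1
    ext p q
    simp only [choi_apply, ampliation, Matrix.of_apply]
    refine congrFun (congrFun (congrArg (fun Y => Φ Y) ?_) p.2) q.2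
    ext i j
    simp only [Matrix.single_apply, Matrix.of_apply, Matrix.vecMulVec_apply, Pi.star_apply]
    by_cases h1 : p.1 = i <;> by_cases h2 : q.1 = j <;> simp [h1, h2]
  · intro h k X hX
    -- Pair the input index of X with that of the Choi matrix; contracting both against the all-ones
    -- vector yields the ampliation.
    have h1 := posSemidef_compress ((hX.kronecker h).submatrix
      fun t : Fin d × (Fin k × m) => ((t.2.1, t.1), (t.1, t.2.2))) fun _ => 1
    convert h1 using 1
    ext p q
    simp [ampliation, apply_eq_sum_choi]

theorem IsCP.posSemidef_apply {n : Type} {Φ : SuperOp n m} (h : IsCP Φ)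
    {X : Op n} (hX : X.PosSemidef) : (Φ X).PosSemidef :=
  (h 1 (X.submatrix Prod.snd Prod.snd) (hX.submatrix _)).submatrix fun a => ((0 : Fin 1), a)

theorem choi_traceReplace (σ : Op m) :
    choi (traceReplace (Fin d) σ) = (1 : Op (Fin d)) ⊗ₖ σ := by
  ext p q
  simp only [choi_apply, traceReplace, LinearMap.smulRight_apply, Matrix.traceLinearMap_apply,
    Matrix.kroneckerMap_apply, Matrix.smul_apply, smul_eq_mul]
  congr 1
  by_cases h : p.1 = q.1
  · rw [h, Matrix.trace_single_eq_same, Matrix.one_apply_eq]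
  · rw [Matrix.trace_single_eq_of_ne _ _ _ h, Matrix.one_apply_ne h]

theorem trace_choi [Fintype m] {Φ : SuperOp (Fin d) m} (h : ∀ X, (Φ X).trace = X.trace) :
    (choi Φ).trace = d := by
  have : (choi Φ).trace = ∑ i : Fin d, (Φ (Matrix.single i i 1)).trace := by
    simp [Matrix.trace, Fintype.sum_prod_type, choi_apply]
  rw [this]
  simp [h]

theorem isCP_traceReplace [Fintype m] {σ : Op m} (hσ : σ.PosSemidef) :
    IsCP (traceReplace (Fin d) σ) := by
  rw [isCP_iff_posSemidef_choi, choi_traceReplace]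
  exact Matrix.PosSemidef.one.kronecker hσ

theorem trace_traceReplace [Fintype m] (σ : Op m) (X : Op (Fin d)) :
    (traceReplace (Fin d) σ X).trace = X.trace * σ.trace := by
  simp [traceReplace]

theorem isChannel_traceReplace [Fintype m] {σ : Op m} (hσ : IsState σ) :
    IsChannel (traceReplace (Fin d) σ) :=
  ⟨isCP_traceReplace hσ.1, fun X => by rw [trace_traceReplace, hσ.2, mul_one]⟩

theorem isCP_krausMap {κ n m : Type} [Fintype κ] [Fintype n] (K : κ → Matrix m n ℂ) [Finite m] :
    IsCP (krausMap K) := by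
  intro k X hX
  have h : ampliation k (krausMap K) X =
      ∑ c, ((1 : Op (Fin k)) ⊗ₖ K c) * X * ((1 : Op (Fin k)) ⊗ₖ K c).conjTranspose := by
    ext p q
    simp [ampliation, krausMap, Matrix.sum_apply, Matrix.mul_apply, Fintype.sum_prod_type,
      Matrix.one_apply, Finset.sum_mul]
    refine Finset.sum_congr rfl fun c _ => ?_
    rw [Finset.sum_eq_single q.1 (fun x _ hx => by simp [hx.symm]) (by simp)]
    simp
  rw [h]
  exact Matrix.posSemidef_sum _ fun c _ => hX.mul_mul_conjTranspose_same _

end Choi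

/-! ### Robustness measures -/

section Robustness

theorem isLeast_opFeasible {n : Type} [Fintype n] {γ X : Op n} (h : (opFeasible γ X).Nonempty)
    {b : ℝ} (hb : ∀ s ∈ opFeasible γ X, b ≤ s) : IsLeast (opFeasible γ X) (RTop γ X) := by
  have hc : IsClosed (opFeasible γ X) :=
    isClosed_posSemidef.preimage (f := fun s : ℝ => (1 + s) • γ - X) (by fun_prop)
  have hbd : BddBelow (opFeasible γ X) := ⟨b, hb⟩
  exact ⟨hc.csInf_mem h hbd, fun s hs => csInf_le hbd hs⟩

variable {d : ℕ} {m : Type} [Fintype m]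

theorem mapFeasible_singleton (Z Λ : SuperOp (Fin d) m) :
    mapFeasible {Z} Λ = opFeasible (choi Z) (choi Λ) := by
  ext s
  simp [mapFeasible, opFeasible, MapLE, OpLE, isCP_iff_posSemidef_choi, choi_sub, choi_smul]

/-- Trace-preserving maps have Choi trace d, so the positive Choi matrix of (1+s)Z - Λ has trace
s·d. -/
theorem nonneg_of_mapFeasible {F : Set (SuperOp (Fin d) m)} {Λ : SuperOp (Fin d) m}
    (hF : ∀ Z ∈ F, ∀ X, (Z X).trace = X.trace) (hΛ : ∀ X, (Λ X).trace = X.trace)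
    (hd : 0 < d) {s : ℝ} (hs : s ∈ mapFeasible F Λ) : 0 ≤ s := by
  obtain ⟨Z, hZ, h⟩ := hs
  have h1 := ((isCP_iff_posSemidef_choi _).1 h).trace_nonneg
  rw [choi_sub, choi_smul, Matrix.trace_sub, Matrix.trace_smul, trace_choi (hF Z hZ),
    trace_choi hΛ, Complex.real_smul] at h1
  have h2 : (0 : ℂ) ≤ ((s * d : ℝ) : ℂ) := by
    convert h1 using 1
    push_cast
    ring
  rw [Complex.zero_le_real] at h2
  have : (0 : ℝ) < d := by exact_mod_cast hd
  exact nonneg_of_mul_nonneg_left h2 this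

/-- For a channel the dynamical robustness of athermality is the static robustness of the image of
the thermal state. -/
theorem mapFeasible_GPO {γA : Op (Fin d)} {γB : Op m} (hA : IsState γA) (hB : IsState γB)
    {Λ : SuperOp (Fin d) m} (hΛ : IsChannel Λ) :
    mapFeasible (GPO γA γB) Λ = opFeasible γB (Λ γA) := by
  ext s
  constructor
  · rintro ⟨Z, ⟨-, hZ⟩, h⟩
    have := IsCP.posSemidef_apply h hA.1
    rwa [LinearMap.sub_apply, LinearMap.smul_apply, hZ] at this
  · intro h
    have h : ((1 + s) • γB - Λ γA).PosSemidef := h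
    have htr : ((1 + s) • γB - Λ γA).trace = (s : ℂ) := by
      rw [Matrix.trace_sub, Matrix.trace_smul, hB.2, hΛ.2, hA.2, Complex.real_smul]
      push_cast
      ring
    have hs : 0 ≤ s := by
      have := h.trace_nonneg
      rwa [htr, Complex.zero_le_real] at this
    have hs1 : (1 + s) ≠ 0 := by positivity
    have heq : (1 + s) • ((1 + s)⁻¹ • (Λ + traceReplace (Fin d) ((1 + s) • γB - Λ γA))) - Λ =
        traceReplace (Fin d) ((1 + s) • γB - Λ γA) := by
      rw [smul_inv_smul₀ hs1, add_sub_cancel_left]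
    -- The deficit (1+s)γB - Λ(γA) is positive with trace s. Adding it to Λ as a trace-and-replace
    -- map and normalising gives a Gibbs-preserving channel.
    refine ⟨(1 + s)⁻¹ • (Λ + traceReplace (Fin d) ((1 + s) • γB - Λ γA)), ⟨⟨?_, ?_⟩, ?_⟩, ?_⟩
    · have h1 := (isCP_iff_posSemidef_choi _).1 hΛ.1
      have h2 := (isCP_iff_posSemidef_choi _).1 (isCP_traceReplace (d := d) h)
      rw [isCP_iff_posSemidef_choi, choi_smul, choi_add]
      exact (h1.add h2).smul (by positivity)
    · intro X
      rw [LinearMap.smul_apply, LinearMap.add_apply, Matrix.trace_smul, Matrix.trace_add, hΛ.2,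
        trace_traceReplace, htr, Complex.real_smul]
      have : (1 + (s : ℂ)) ≠ 0 := by exact_mod_cast hs1
      push_cast
      field_simp
    · rw [LinearMap.smul_apply, LinearMap.add_apply, traceReplace, LinearMap.smulRight_apply,
        Matrix.traceLinearMap_apply, hA.2, one_smul, add_sub_cancel, inv_smul_smul₀ hs1]
    · rw [MapLE, heq]
      exact isCP_traceReplace h

theorem isCompact_setOf_isState : IsCompact {σ : Op m | IsState σ} := by
  have h1 : IsCompact {σ : Op m | ∀ i j, ‖σ i j‖ ≤ 1} := by
    have : {σ : Op m | ∀ i j, ‖σ i j‖ ≤ 1} =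
        Set.pi Set.univ fun _ => Set.pi Set.univ fun _ => Metric.closedBall (0 : ℂ) 1 := by
      ext σ
      exact ⟨fun h i _ j _ => by simpa using h i j, fun h i j => by simpa using h i trivial j trivial⟩
    rw [this]
    exact isCompact_univ_pi fun _ => isCompact_univ_pi fun _ => isCompact_closedBall _ _
  refine h1.of_isClosed_subset ?_ fun σ hσ => norm_apply_le_one hσ.1 hσ.2
  exact isClosed_posSemidef.inter (isClosed_eq (by fun_prop) continuous_const)

/-- The state σ varies with s, so attainment comes from compactness of the feasible pairs (s, σ)
with 0 ≤ s ≤ r. -/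
theorem isLeast_mapFeasible_NSO {Λ : SuperOp (Fin d) m} (hΛ : ∀ X, (Λ X).trace = X.trace)
    (hd : 0 < d) {r : ℝ} (hr : r ∈ mapFeasible (NSO (Fin d) m) Λ) :
    IsLeast (mapFeasible (NSO (Fin d) m) Λ) (RS Λ) := by
  have hnn : ∀ s ∈ mapFeasible (NSO (Fin d) m) Λ, 0 ≤ s := fun s hs =>
    nonneg_of_mapFeasible (by
      rintro _ ⟨σ, hσ, rfl⟩ X
      rw [trace_traceReplace, hσ.2, mul_one]) hΛ hd hs
  have hmem : ∀ s, s ∈ mapFeasible (NSO (Fin d) m) Λ ↔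
      ∃ σ : Op m, IsState σ ∧ ((1 + s) • ((1 : Op (Fin d)) ⊗ₖ σ) - choi Λ).PosSemidef := by
    intro s
    constructor
    · rintro ⟨_, ⟨σ, hσ, rfl⟩, h⟩
      refine ⟨σ, hσ, ?_⟩
      have := (isCP_iff_posSemidef_choi _).1 h
      rwa [choi_sub, choi_smul, choi_traceReplace] at this
    · rintro ⟨σ, hσ, h⟩
      refine ⟨_, ⟨σ, hσ, rfl⟩, ?_⟩
      rw [MapLE, isCP_iff_posSemidef_choi, choi_sub, choi_smul, choi_traceReplace]
      exact h
  have hK : IsCompact ((Set.Icc 0 r ×ˢ {σ : Op m | IsState σ}) ∩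
      {p : ℝ × Op m | ((1 + p.1) • ((1 : Op (Fin d)) ⊗ₖ p.2) - choi Λ).PosSemidef}) := by
    refine (isCompact_Icc.prod isCompact_setOf_isState).inter_right ?_
    refine isClosed_posSemidef.preimage
      (f := fun p : ℝ × Op m => (1 + p.1) • ((1 : Op (Fin d)) ⊗ₖ p.2) - choi Λ) ?_
    refine ((continuous_const.add continuous_fst).smul ?_).sub continuous_const
    refine continuous_matrix fun i j => ?_
    simp only [Matrix.kroneckerMap_apply]
    fun_prop
  obtain ⟨σr, hσr, hr'⟩ := (hmem r).1 hr
  obtain ⟨⟨s, σ⟩, ⟨⟨-, hσ⟩, hs⟩, hmin⟩ := hK.exists_isMinOn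
    ⟨(r, σr), ⟨⟨hnn r hr, le_rfl⟩, hσr⟩, hr'⟩ continuous_fst.continuousOn
  have hleast : IsLeast (mapFeasible (NSO (Fin d) m) Λ) s := by
    refine ⟨(hmem s).2 ⟨σ, hσ, hs⟩, fun t ht => ?_⟩
    rcases le_total t r with htr | htr
    · obtain ⟨σt, hσt, ht'⟩ := (hmem t).1 ht
      exact hmin (a := (t, σt)) ⟨⟨⟨hnn t ht, htr⟩, hσt⟩, ht'⟩
    · exact (hmin (a := (r, σr)) ⟨⟨⟨hnn r hr, le_rfl⟩, hσr⟩, hr'⟩).trans htr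
  rw [RS, hleast.csInf_eq]
  exact hleast

end Robustness

/-! ### Qubit operators -/

section Qubit

/-- The operator `e^{-iφ} |0⟩⟨1| + e^{iφ} |1⟩⟨0|`. -/
def phaseFlip (φ : ℝ) : Op (Fin 2) :=
  Matrix.single (0 : Fin 2) (1 : Fin 2) (Complex.exp (-(Complex.I * φ))) +
    Matrix.single (1 : Fin 2) (0 : Fin 2) (Complex.exp (Complex.I * φ))

theorem star_exp_I_mul (φ : ℝ) :
    (starRingEnd ℂ) (Complex.exp (Complex.I * φ)) = Complex.exp (-(Complex.I * φ)) := by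
  rw [← Complex.exp_conj]
  simp

theorem exp_mul_exp_neg (z : ℂ) : Complex.exp z * Complex.exp (-z) = 1 := by
  rw [← Complex.exp_add, add_neg_cancel, Complex.exp_zero]

theorem vecMulVec_phase {p q : ℝ} (hp : 0 ≤ p) (hq : 0 ≤ q) (φ ε : ℝ) (hε : ε ^ 2 = 1) :
    Matrix.vecMulVec ![(Real.sqrt p : ℂ), ε * Complex.exp (Complex.I * φ) * (Real.sqrt q : ℂ)]
      (star ![(Real.sqrt p : ℂ), ε * Complex.exp (Complex.I * φ) * (Real.sqrt q : ℂ)]) =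
      realDiag ![p, q] + (ε * Real.sqrt (p * q)) • phaseFlip φ := by
  have hp' : (Real.sqrt p : ℂ) * Real.sqrt p = p := by
    rw [← Complex.ofReal_mul, Real.mul_self_sqrt hp]
  have hq' : (Real.sqrt q : ℂ) * Real.sqrt q = q := by
    rw [← Complex.ofReal_mul, Real.mul_self_sqrt hq]
  have he := exp_mul_exp_neg (Complex.I * φ)
  have hε' : (ε : ℂ) ^ 2 = 1 := by exact_mod_cast hε
  rw [Real.sqrt_mul hp]
  ext a b
  fin_cases a <;> fin_cases b <;>
    simp [Matrix.vecMulVec_apply, realDiag, phaseFlip, star_exp_I_mul]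
  · exact hp'
  · ring
  · ring
  · linear_combination (ε : ℂ) ^ 2 * (Complex.exp (Complex.I * φ) *
      Complex.exp (-(Complex.I * φ))) * hq' + (q : ℂ) * ε ^ 2 * he + (q : ℂ) * hε'

theorem controlState_eq {α : ℝ} (h0 : 0 ≤ α) (h1 : α ≤ 1) (φ : ℝ) :
    controlState α φ =
      realDiag ![α, 1 - α] + Real.sqrt (α * (1 - α)) • phaseFlip φ := by
  have := vecMulVec_phase h0 (sub_nonneg.2 h1) φ 1 (by norm_num)
  simpa [controlState] using this

/-- The matrix is a mixture, with weights (1±l)/2, of the two rank-one matrices with the same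
diagonal and off-diagonal part ±√(pq) F. -/
theorem posSemidef_qubit {p q c : ℝ} (hp : 0 ≤ p) (hq : 0 ≤ q) (hc : c ^ 2 ≤ p * q) (φ : ℝ) :
    (realDiag ![p, q] + c • phaseFlip φ).PosSemidef := by
  obtain ⟨l, hl1, hl2, hl⟩ : ∃ l : ℝ, -1 ≤ l ∧ l ≤ 1 ∧ c = l * Real.sqrt (p * q) := by
    have habs : |c| ≤ Real.sqrt (p * q) := Real.abs_le_sqrt hc
    rcases (Real.sqrt_nonneg (p * q)).eq_or_lt with h | h
    · refine ⟨0, by norm_num, by norm_num, ?_⟩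
      rw [← h] at habs
      simpa using habs
    · rw [abs_le] at habs
      refine ⟨c / Real.sqrt (p * q), ?_, ?_, ?_⟩
      · rw [le_div_iff₀ h]; linarith
      · rw [div_le_iff₀ h]; linarith
      · field_simp
  have e1 := vecMulVec_phase hp hq φ 1 (by norm_num)
  have e2 := vecMulVec_phase hp hq φ (-1) (by norm_num)
  have h1 : (realDiag ![p, q] + (1 * Real.sqrt (p * q)) • phaseFlip φ).PosSemidef :=
    e1 ▸ Matrix.posSemidef_vecMulVec_self_star _
  have h2 : (realDiag ![p, q] + (-1 * Real.sqrt (p * q)) • phaseFlip φ).PosSemidef :=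
    e2 ▸ Matrix.posSemidef_vecMulVec_self_star _
  have := (h1.smul (show 0 ≤ (1 + l) / 2 by linarith)).add
    (h2.smul (show 0 ≤ (1 - l) / 2 by linarith))
  convert this using 1
  rw [hl]
  module

theorem qubit_bounds_of_posSemidef {p q c φ : ℝ}
    (h : (realDiag ![p, q] + c • phaseFlip φ).PosSemidef) : 0 ≤ p ∧ 0 ≤ q ∧ c ^ 2 ≤ p * q := by
  have h0 := h.diag_nonneg (i := 0)
  have h1 := h.diag_nonneg (i := 1)
  have hd := h.det_nonneg
  have he := exp_mul_exp_neg (Complex.I * φ)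
  rw [Matrix.det_fin_two] at hd
  simp [realDiag, phaseFlip] at h0 h1 hd
  refine ⟨by exact_mod_cast h0, by exact_mod_cast h1, ?_⟩
  have : (c : ℂ) * Complex.exp (-(Complex.I * φ)) * (c * Complex.exp (Complex.I * φ)) =
      (c : ℂ) ^ 2 := by
    linear_combination (c : ℂ) ^ 2 * he
  rw [this] at hd
  exact_mod_cast hd

/-- With t = (1+s)/2 the determinant is (t-α)(t-1+α) - α(1-α) = t² - t, whatever α and φ; the
diagonal entries force t ≥ 1/2, so t ≥ 1. -/
theorem isLeast_opFeasible_controlState {α : ℝ} (h0 : 0 ≤ α) (h1 : α ≤ 1) (φ : ℝ) :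
    IsLeast (opFeasible thermalC (controlState α φ)) 1 := by
  have heq : ∀ s : ℝ, (1 + s) • thermalC - controlState α φ =
      realDiag ![(1 + s) / 2 - α, (1 + s) / 2 - (1 - α)] +
        (-Real.sqrt (α * (1 - α))) • phaseFlip φ := by
    intro s
    rw [controlState_eq h0 h1]
    ext a b
    fin_cases a <;> fin_cases b <;> simp [thermalC, realDiag, phaseFlip] <;> ring
  have hsq : (-Real.sqrt (α * (1 - α))) ^ 2 = α * (1 - α) := by
    rw [neg_sq, Real.sq_sqrt (mul_nonneg h0 (sub_nonneg.2 h1))]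
  constructor
  · rw [opFeasible, Set.mem_ofPred_eq, OpLE, heq]
    refine posSemidef_qubit (by linarith) (by linarith) (le_of_eq ?_) φ
    rw [hsq]
    ring
  · intro s hs
    rw [opFeasible, Set.mem_ofPred_eq, OpLE, heq] at hs
    obtain ⟨hp, hq, hc⟩ := qubit_bounds_of_posSemidef hs
    rw [hsq] at hc
    nlinarith

end Qubit

/-! ### Coherent control -/

section Control

/-- In diagonal blocks one of the two Kraus sums is free and cancels 1/N. In off-diagonal blocks the
double sum factorises through ∑ K, so the interference depends on the Kraus representation and not
only on the channel. -/
theorem controlled_apply {κ n : Type} [Fintype κ] [Nonempty κ] [Fintype n] (K : κ → Op n)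
    (ρ : Op (Fin 2)) (X : Op n) :
    controlled K ρ X =
      (Matrix.single 0 0 (ρ 0 0) + Matrix.single 1 1 (ρ 1 1)) ⊗ₖ krausMap K X +
      ((Fintype.card κ : ℝ)⁻¹) • ((Matrix.single 0 1 (ρ 0 1) + Matrix.single 1 0 (ρ 1 0)) ⊗ₖ
        ((∑ k, K k) * X * (∑ k, K k).conjTranspose)) := by
  have hN : (0 : ℝ) < Fintype.card κ := by exact_mod_cast Fintype.card_pos
  have hE : ∀ a b : Fin 2, Matrix.single a a (1 : ℂ) * ρ * Matrix.single b b (1 : ℂ) =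
      Matrix.single a b (ρ a b) := by
    intro a b
    simp
  have h1 : ∀ pq : κ × κ, controlKraus K pq * (ρ ⊗ₖ X) * (controlKraus K pq).conjTranspose =
      ((Fintype.card κ : ℝ)⁻¹) •
        (Matrix.single 0 0 (ρ 0 0) ⊗ₖ (K pq.1 * X * (K pq.1).conjTranspose) +
        Matrix.single 1 1 (ρ 1 1) ⊗ₖ (K pq.2 * X * (K pq.2).conjTranspose) +
        (Matrix.single 0 1 (ρ 0 1) ⊗ₖ (K pq.1 * X * (K pq.2).conjTranspose) +
        Matrix.single 1 0 (ρ 1 0) ⊗ₖ (K pq.2 * X * (K pq.1).conjTranspose))) := by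
    intro pq
    have hc : ((((Real.sqrt (Fintype.card κ))⁻¹ : ℝ) : ℂ)) *
        (((Real.sqrt (Fintype.card κ))⁻¹ : ℝ) : ℂ) = (((Fintype.card κ : ℝ)⁻¹ : ℝ) : ℂ) := by
      rw [← Complex.ofReal_mul, ← mul_inv, Real.mul_self_sqrt hN.le]
    rw [controlKraus, Matrix.conjTranspose_smul, Matrix.smul_mul, Matrix.smul_mul,
      Matrix.mul_smul, smul_smul, Complex.star_def, Complex.conj_ofReal, hc,
      Complex.coe_smul, Matrix.conjTranspose_add, Matrix.conjTranspose_kronecker,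
      Matrix.conjTranspose_kronecker, Matrix.conjTranspose_single, Matrix.conjTranspose_single,
      star_one]
    simp only [Matrix.add_mul, Matrix.mul_add, ← Matrix.mul_kronecker_mul, hE]
    congr 1
    abel
  have h2 : controlled K ρ X = ∑ pq : κ × κ,
      controlKraus K pq * (ρ ⊗ₖ X) * (controlKraus K pq).conjTranspose := rfl
  rw [h2, Finset.sum_congr rfl fun pq _ => h1 pq]
  have hk : krausMap K X = ∑ k, K k * X * (K k).conjTranspose := rfl
  ext ⟨a, x⟩ ⟨b, y⟩
  have hNC : (Fintype.card κ : ℂ) ≠ 0 := by exact_mod_cast hN.ne'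
  fin_cases a <;> fin_cases b <;>
    simp [Fintype.sum_prod_type, Matrix.sum_apply, hk, Matrix.sum_mul,
      Matrix.mul_sum, Matrix.conjTranspose_sum, ← Finset.mul_sum]
  · field_simp
  · exact Or.inl Finset.sum_comm
  · field_simp

end Control

/-! ### The Choi matrix of the controlled channel -/

section LamC

variable {d : ℕ}

theorem isCP_controlled {κ n : Type} [Fintype κ] [Fintype n] (K : κ → Op n) {ρ : Op (Fin 2)}
    (hρ : ρ.PosSemidef) : IsCP (controlled K ρ) := by
  intro k X hX
  have h1 := (hρ.kronecker hX).submatrix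
    fun t : Fin k × (Fin 2 × n) => (t.2.1, (t.1, t.2.2))
  have h2 := isCP_krausMap (controlKraus K) k _ h1
  convert h2 using 1
  ext p q
  simp only [ampliation, Matrix.of_apply, controlled, LinearMap.coe_mk, AddHom.coe_mk]
  refine congrFun (congrFun (congrArg (fun Y => krausMap (controlKraus K) Y) ?_) p.2) q.2
  ext a b
  simp

/-- The number of nonzero members of `allKraus g s`. -/
def krausCard (d : ℕ) (s : ℝ) : ℝ := (if s = 1 then 0 else 1) + (if s = 0 then 0 else (d : ℝ) ^ 2)

theorem one_le_krausCard (hd : 0 < d) (s : ℝ) : 1 ≤ krausCard d s := by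
  have : (1 : ℝ) ≤ (d : ℝ) ^ 2 := by
    have : (1 : ℝ) ≤ d := by exact_mod_cast hd
    nlinarith
  rw [krausCard]
  split_ifs with h1 h2
  · exfalso; linarith
  · linarith
  · linarith
  · linarith

open Classical in
theorem card_krausG (hd : 0 < d) {g : Fin d → ℝ} (hg : ∀ i, 0 < g i) {s : ℝ} (hs0 : 0 ≤ s)
    (hs1 : s ≤ 1) : (Fintype.card {x // allKraus g s x ≠ 0} : ℝ) = krausCard d s := by
  have hnone : allKraus g s none ≠ 0 ↔ s ≠ 1 := by
    rw [not_iff_not]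
    have : Nonempty (Fin d) := ⟨⟨0, hd⟩⟩
    simp only [allKraus, smul_eq_zero, one_ne_zero, or_false, Complex.ofReal_eq_zero,
      Real.sqrt_eq_zero (sub_nonneg.2 hs1)]
    constructor <;> intro h <;> linarith
  have hsome : ∀ i j, allKraus g s (some (i, j)) ≠ 0 ↔ s ≠ 0 := by
    intro i j
    rw [not_iff_not]
    have hz : allKraus g s (some (i, j)) = 0 ↔ ((Real.sqrt s * Real.sqrt (g j) : ℝ) : ℂ) = 0 := by
      refine ⟨fun h => by simpa [allKraus] using congrFun (congrFun h j) i, fun h => ?_⟩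
      rw [allKraus, h, Matrix.single_zero]
    rw [hz, Complex.ofReal_eq_zero, mul_eq_zero, Real.sqrt_eq_zero hs0,
      or_iff_left (Real.sqrt_pos.2 (hg j)).ne']
  rw [Fintype.card_subtype, Finset.card_filter, Fintype.sum_option]
  simp only [Fintype.sum_prod_type, hnone, hsome]
  rw [krausCard]
  split_ifs <;> simp_all [sq]

-- Discarded zero operators do not affect the sum, so one formula serves all s; only the
-- normalisation N jumps at s = 0 and s = 1.
open Classical in
theorem sum_krausG (g : Fin d → ℝ) (s : ℝ) : ∑ k, krausG g s k =
    Matrix.of fun x i => ((Real.sqrt s * Real.sqrt (g x) : ℝ) : ℂ) +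
      if x = i then (Real.sqrt (1 - s) : ℂ) else 0 := by
  have h1 : ∑ k, krausG g s k = ∑ k, allKraus g s k := by
    simp only [krausG]
    rw [← Finset.sum_subtype (p := fun x => allKraus g s x ≠ 0)
      (Finset.univ.filter fun x => allKraus g s x ≠ 0) (by simp) fun k => allKraus g s k]
    refine Finset.sum_subset (Finset.filter_subset _ _) fun x _ hx => ?_
    simpa using hx
  rw [h1, Fintype.sum_option, Fintype.sum_prod_type]
  ext x i
  simp only [allKraus, Matrix.add_apply, Matrix.sum_apply, Matrix.single_apply,
    Matrix.smul_apply, Matrix.one_apply, Matrix.of_apply]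
  rw [add_comm]
  congr 1
  · simp [ite_and]
  · simp

open Classical in
theorem LamC_apply (hd : 0 < d) {g : Fin d → ℝ} (hg : ∀ i, 0 < g i) {s : ℝ} (hs0 : 0 ≤ s)
    (hs1 : s ≤ 1) {α : ℝ} (h0 : 0 ≤ α) (h1 : α ≤ 1) (φ : ℝ) (X : Op (Fin d)) :
    LamC g s α φ X = realDiag ![α, 1 - α] ⊗ₖ G g s X +
      ((krausCard d s)⁻¹ * Real.sqrt (α * (1 - α))) • (phaseFlip φ ⊗ₖ
        ((∑ k, krausG g s k) * X * (∑ k, krausG g s k).conjTranspose)) := by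
  have hpos : (0 : ℝ) < Fintype.card {x // allKraus g s x ≠ 0} := by
    rw [card_krausG hd hg hs0 hs1]
    linarith [one_le_krausCard hd s]
  have : Nonempty {x // allKraus g s x ≠ 0} := Fintype.card_pos_iff.1 (by exact_mod_cast hpos)
  have hD : Matrix.single 0 0 (controlState α φ 0 0) + Matrix.single 1 1 (controlState α φ 1 1) =
      realDiag ![α, 1 - α] := by
    rw [controlState_eq h0 h1]
    ext a b
    fin_cases a <;> fin_cases b <;> simp [realDiag, phaseFlip]
  have hO : Matrix.single 0 1 (controlState α φ 0 1) + Matrix.single 1 0 (controlState α φ 1 0) =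
      Real.sqrt (α * (1 - α)) • phaseFlip φ := by
    rw [controlState_eq h0 h1]
    ext a b
    fin_cases a <;> fin_cases b <;> simp [realDiag, phaseFlip]
  rw [LamC, controlled_apply, krausMap_krausG g hg s hs0 hs1, card_krausG hd hg hs0 hs1, hD, hO,
    Matrix.smul_kronecker, smul_smul]

theorem isChannel_LamC (hd : 0 < d) {g : Fin d → ℝ} (hg : ∀ i, 0 < g i) (hsum : ∑ i, g i = 1)
    {s : ℝ} (hs0 : 0 ≤ s) (hs1 : s ≤ 1) {α : ℝ} (h0 : 0 ≤ α) (h1 : α ≤ 1) (φ : ℝ) :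
    IsChannel (LamC g s α φ) := by
  refine ⟨isCP_controlled _ (Matrix.posSemidef_vecMulVec_self_star _), fun X => ?_⟩
  have hsumC : ∑ i, (g i : ℂ) = 1 := by exact_mod_cast hsum
  rw [LamC_apply hd hg hs0 hs1 h0 h1, Matrix.trace_add, Matrix.trace_smul, Matrix.trace_kronecker,
    Matrix.trace_kronecker]
  simp [realDiag, phaseFlip, G, Gam, traceReplace, thermal, hsumC]
  ring

/-- The unnormalised maximally entangled vector. -/
def maxEntVec (d : ℕ) : Fin d × Fin d → ℂ := fun p => if p.1 = p.2 then 1 else 0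

/-- The vectorisation of `∑ √g_j |j⟩⟨i|`. -/
def sqrtVec (g : Fin d → ℝ) : Fin d × Fin d → ℂ := fun p => (Real.sqrt (g p.2) : ℂ)

/-- The weights of `𝟙 ⊗ γ`. -/
def sndWeight (g : Fin d → ℝ) : Fin d × Fin d → ℝ := fun p => g p.2

theorem choi_G (g : Fin d → ℝ) (s : ℝ) : choi (G g s) = s • realDiag (sndWeight g) +
    (1 - s) • Matrix.vecMulVec (maxEntVec d) (star (maxEntVec d)) := by
  rw [G, choi_add, choi_smul, choi_smul, Gam, choi_traceReplace]
  congr 2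
  · ext ⟨i, x⟩ ⟨j, y⟩
    by_cases hij : i = j <;> by_cases hxy : x = y <;>
      simp [realDiag, thermal, sndWeight, hij, hxy]
  · ext ⟨i, x⟩ ⟨j, y⟩
    simp [choi_apply, maxEntVec, Matrix.vecMulVec_apply, Matrix.single_apply, apply_ite]
    by_cases h1 : i = x <;> by_cases h2 : j = y <;> simp [h1, h2]

/-- Moves the control qubit to the front. -/
def controlFirst (d : ℕ) : Fin 2 × (Fin d × Fin d) ≃ Fin d × (Fin 2 × Fin d) where
  toFun p := (p.2.1, (p.1, p.2.2))
  invFun p := (p.2.1, (p.1, p.2.2))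
  left_inv _ := rfl
  right_inv _ := rfl

/-- The interference term is rank one on the target because X ↦ (∑ K) X (∑ K)† has a single Kraus
operator. -/
theorem choi_LamC (hd : 0 < d) {g : Fin d → ℝ} (hg : ∀ i, 0 < g i) {s : ℝ} (hs0 : 0 ≤ s)
    (hs1 : s ≤ 1) {α : ℝ} (h0 : 0 ≤ α) (h1 : α ≤ 1) (φ : ℝ) :
    (choi (LamC g s α φ)).submatrix (controlFirst d) (controlFirst d) =
      realDiag ![α, 1 - α] ⊗ₖ (s • realDiag (sndWeight g) +
        (1 - s) • Matrix.vecMulVec (maxEntVec d) (star (maxEntVec d))) +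
      ((krausCard d s)⁻¹ * Real.sqrt (α * (1 - α))) • (phaseFlip φ ⊗ₖ
        Matrix.vecMulVec (Real.sqrt s • sqrtVec g + Real.sqrt (1 - s) • maxEntVec d)
          (star (Real.sqrt s • sqrtVec g + Real.sqrt (1 - s) • maxEntVec d))) := by
  classical
  rw [← choi_G]
  ext ⟨a, i, x⟩ ⟨b, j, y⟩
  rw [Matrix.submatrix_apply, choi_apply, LamC_apply hd hg hs0 hs1 h0 h1, sum_krausG]
  simp only [Matrix.add_apply, Matrix.smul_apply, Matrix.kroneckerMap_apply, controlFirst,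
    Equiv.coe_fn_mk, choi_apply]
  congr 3
  rw [Matrix.mul_single_eq_updateCol_zero]
  simp [Matrix.mul_apply, Matrix.vecMulVec_apply, sqrtVec, maxEntVec, Matrix.updateCol_apply]
  by_cases hx : x = i <;> by_cases hy : y = j <;> simp [hx, hy, Ne.symm]

theorem opFeasible_choi_LamC (g : Fin d → ℝ) (Λ : SuperOp (Fin d) (Fin 2 × Fin d)) :
    opFeasible (choi (traceReplace (Fin d) (thermalOut g))) (choi Λ) =
      {r | (((1 + r) / 2) • ((1 : Op (Fin 2)) ⊗ₖ realDiag (sndWeight g)) -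
        (choi Λ).submatrix (controlFirst d) (controlFirst d)).PosSemidef} := by
  ext r
  rw [opFeasible, Set.mem_ofPred_eq, Set.mem_ofPred_eq, OpLE,
    ← Matrix.posSemidef_submatrix_equiv (controlFirst d), choi_traceReplace]
  convert Iff.rfl using 2
  ext ⟨a, i, x⟩ ⟨b, j, y⟩
  simp only [Matrix.sub_apply, Matrix.submatrix_apply, sub_left_inj]
  by_cases hab : a = b <;> by_cases hij : i = j <;> by_cases hxy : x = y <;>
    simp [thermalOut, thermalC, thermal, realDiag, sndWeight, controlFirst, hab, hij, hxy]
  all_goals ring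

end LamC

/-! ### The robustness of `χ` -/

section Chi

variable {d : ℕ}

/-- The weights of `γ ⊗ γ`. -/
def prodWeight (g : Fin d → ℝ) : Fin d × Fin d → ℝ := fun p => g p.1 * g p.2

theorem mem_opFeasible_chi (g : Fin d → ℝ) (φ r : ℝ) :
    r ∈ opFeasible (thermalChi g) (chi g φ) ↔
      (((1 + r) / 2) • ((1 : Op (Fin 2)) ⊗ₖ realDiag (prodWeight g)) -
        phaseFlip φ ⊗ₖ tau g).PosSemidef := by
  have h : (1 + r) • thermalChi g =
      ((1 + r) / 2) • ((1 : Op (Fin 2)) ⊗ₖ realDiag (prodWeight g)) := by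
    have h1 : thermal g ⊗ₖ thermal g = realDiag (prodWeight g) := by
      ext ⟨i, x⟩ ⟨j, y⟩
      by_cases hij : i = j <;> by_cases hxy : x = y <;>
        simp [realDiag, thermal, prodWeight, hij, hxy]
    rw [thermalChi, h1, thermalC, Matrix.smul_kronecker]
    ext a b
    simp only [Matrix.smul_apply, Complex.real_smul, smul_eq_mul]
    push_cast
    ring
  rw [← h]
  rfl

/-- Conjugating the control by diag(1, e^{i(φ'-φ)}) shifts the phase and fixes the thermal state. -/
theorem opFeasible_chi_subset (g : Fin d → ℝ) (φ φ' : ℝ) :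
    opFeasible (thermalChi g) (chi g φ) ⊆ opFeasible (thermalChi g) (chi g φ') := by
  intro r hr
  rw [mem_opFeasible_chi] at hr ⊢
  let u : Op (Fin 2) := Matrix.diagonal ![1, Complex.exp (Complex.I * (φ' - φ : ℝ))]
  have hu : u.conjTranspose =
      Matrix.diagonal ![1, Complex.exp (-(Complex.I * (φ' - φ : ℝ)))] := by
    ext a b
    fin_cases a <;> fin_cases b <;> simp [u]
    simpa using star_exp_I_mul (φ' - φ)
  have h1 : u * 1 * u.conjTranspose = 1 := by
    have := exp_mul_exp_neg (Complex.I * (φ' - φ : ℝ))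
    rw [hu]
    ext a b
    fin_cases a <;> fin_cases b <;> simp [u]
    simpa using this
  have h2 : u * phaseFlip φ * u.conjTranspose = phaseFlip φ' := by
    rw [hu]
    ext a b
    fin_cases a <;> fin_cases b <;> simp [u, phaseFlip, ← Complex.exp_add] <;> ring_nf
  have := hr.mul_mul_conjTranspose_same (u ⊗ₖ (1 : Op (Fin d × Fin d)))
  rw [Matrix.conjTranspose_kronecker, Matrix.mul_sub, Matrix.sub_mul, Matrix.mul_smul,
    Matrix.smul_mul, ← Matrix.mul_kronecker_mul, ← Matrix.mul_kronecker_mul,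
    ← Matrix.mul_kronecker_mul, ← Matrix.mul_kronecker_mul, h1, h2, Matrix.conjTranspose_one,
    Matrix.one_mul, Matrix.mul_one, Matrix.one_mul, Matrix.mul_one] at this
  exact this

theorem RTop_chi (g : Fin d → ℝ) (φ φ' : ℝ) :
    RTop (thermalChi g) (chi g φ) = RTop (thermalChi g) (chi g φ') := by
  rw [RTop, RTop, (opFeasible_chi_subset g φ φ').antisymm (opFeasible_chi_subset g φ' φ)]

/-- Restricted to the vector |i⟩|i⟩, the matrix is a qubit matrix with nonzero off-diagonal entry,
so its diagonal must be strictly positive. -/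
theorem neg_one_lt_of_mem_opFeasible_chi (hd : 0 < d) {g : Fin d → ℝ} (hg : ∀ i, 0 < g i)
    {φ r : ℝ} (hr : r ∈ opFeasible (thermalChi g) (chi g φ)) : -1 < r := by
  rw [mem_opFeasible_chi] at hr
  let i : Fin d := ⟨0, hd⟩
  have h1 := hr.submatrix fun a : Fin 2 => (a, (i, i))
  have h2 : (((1 + r) / 2) • ((1 : Op (Fin 2)) ⊗ₖ realDiag (prodWeight g)) -
        phaseFlip φ ⊗ₖ tau g).submatrix (fun a : Fin 2 => (a, (i, i)))
          (fun a : Fin 2 => (a, (i, i))) =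
      realDiag ![(1 + r) / 2 * (g i * g i), (1 + r) / 2 * (g i * g i)] +
        (-(2 * (Real.sqrt (g i) * Real.sqrt (g i) * Real.sqrt (g i)))) • phaseFlip φ := by
    ext a b
    fin_cases a <;> fin_cases b <;>
      simp [realDiag, prodWeight, phaseFlip, tau, hatVec, tfdVec, Matrix.vecMulVec_apply] <;> ring
  rw [h2] at h1
  obtain ⟨hp, -, hc⟩ := qubit_bounds_of_posSemidef h1
  have hs := Real.sqrt_pos.2 (hg i)
  have hpos : 0 < (1 + r) / 2 * (g i * g i) := by
    refine hp.lt_of_ne fun h => ?_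
    rw [← h, mul_zero] at hc
    have : 0 < (-(2 * (Real.sqrt (g i) * Real.sqrt (g i) * Real.sqrt (g i)))) ^ 2 := by
      rw [neg_sq]; positivity
    linarith
  have := pos_of_mul_pos_left hpos (mul_pos (hg i) (hg i)).le
  linarith

/-- It equals ½[(𝟙+F) ⊗ (v-w)(v-w)† + (𝟙-F) ⊗ (v+w)(v+w)†]. This makes the feasible set of χ
nonempty. -/
theorem posSemidef_one_kronecker_sub_tau {n : Type} [Fintype n] (v w : n → ℂ) (φ : ℝ) :
    ((1 : Op (Fin 2)) ⊗ₖ (Matrix.vecMulVec v (star v) + Matrix.vecMulVec w (star w)) -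
      phaseFlip φ ⊗ₖ (Matrix.vecMulVec v (star w) + Matrix.vecMulVec w (star v))).PosSemidef := by
  have hone : realDiag ![1, 1] = (1 : Op (Fin 2)) := by
    ext a b
    fin_cases a <;> fin_cases b <;> simp [realDiag]
  have h1 : ((1 : Op (Fin 2)) + (1 : ℝ) • phaseFlip φ).PosSemidef :=
    hone ▸ posSemidef_qubit zero_le_one zero_le_one (by norm_num) φ
  have h2 : ((1 : Op (Fin 2)) + (-1 : ℝ) • phaseFlip φ).PosSemidef :=
    hone ▸ posSemidef_qubit zero_le_one zero_le_one (by norm_num) φ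
  have h := ((h1.kronecker (Matrix.posSemidef_vecMulVec_self_star (v - w))).add
    (h2.kronecker (Matrix.posSemidef_vecMulVec_self_star (v + w)))).smul
    (show (0 : ℝ) ≤ 1 / 2 by norm_num)
  refine posSemidef_of_eq h ?_
  ext ⟨a, i⟩ ⟨b, j⟩
  simp only [Matrix.sub_apply, Matrix.add_apply, Matrix.smul_apply, Matrix.kroneckerMap_apply,
    Matrix.vecMulVec_apply, Pi.star_apply, Pi.add_apply, Pi.sub_apply, star_add, star_sub,
    Complex.real_smul]
  push_cast
  ring

theorem isLeast_opFeasible_chi (hd : 0 < d) {g : Fin d → ℝ} (hg : ∀ i, 0 < g i) (φ : ℝ) :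
    IsLeast (opFeasible (thermalChi g) (chi g φ)) (RTop (thermalChi g) (chi g φ)) := by
  refine isLeast_opFeasible ?_ fun s hs => (neg_one_lt_of_mem_opFeasible_chi hd hg hs).le
  have hw : ∀ p, 0 < prodWeight g p := fun p => mul_pos (hg _) (hg _)
  have h1 := posSemidef_smul_realDiag_sub_vecMulVec hw (le_refl (∑ p, ‖hatVec g p‖ ^ 2 / prodWeight g p))
  have h2 := posSemidef_smul_realDiag_sub_vecMulVec hw (le_refl (∑ p, ‖tfdVec g p‖ ^ 2 / prodWeight g p))
  generalize (∑ p, ‖hatVec g p‖ ^ 2 / prodWeight g p) = c₁ at h1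
  generalize (∑ p, ‖tfdVec g p‖ ^ 2 / prodWeight g p) = c₂ at h2
  have h3 := (Matrix.PosSemidef.one (n := Fin 2) (R := ℂ)).kronecker (h1.add h2)
  have h4 := h3.add (posSemidef_one_kronecker_sub_tau (hatVec g) (tfdVec g) φ)
  refine ⟨2 * (c₁ + c₂) - 1, ?_⟩
  rw [mem_opFeasible_chi]
  refine posSemidef_of_eq h4 ?_
  ext ⟨a, i⟩ ⟨b, j⟩
  simp only [Matrix.sub_apply, Matrix.add_apply, Matrix.smul_apply, Matrix.kroneckerMap_apply,
    Complex.real_smul, tau]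
  push_cast
  ring

theorem fCoeff_pos (hd : 0 < d) {g : Fin d → ℝ} (hg : ∀ i, 0 < g i) : 0 < fCoeff g := by
  have := neg_one_lt_of_mem_opFeasible_chi hd hg (isLeast_opFeasible_chi hd hg 0).1
  exact div_pos (by linarith) (by positivity)

/-- Conjugate the optimal inequality for χ by γ^(-1/2) on the first factor: γ ⊗ γ becomes 𝟙 ⊗ γ,
`hatVec` becomes `sqrtVec`, and `tfdVec` becomes `maxEntVec`. -/
theorem posSemidef_sub_cross (hd : 0 < d) {g : Fin d → ℝ} (hg : ∀ i, 0 < g i) (φ : ℝ) :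
    ((fCoeff g * ((d : ℝ) ^ 2 + 1) / 2) • ((1 : Op (Fin 2)) ⊗ₖ realDiag (sndWeight g)) -
      phaseFlip φ ⊗ₖ (Matrix.vecMulVec (sqrtVec g) (star (maxEntVec d)) +
        Matrix.vecMulVec (maxEntVec d) (star (sqrtVec g)))).PosSemidef := by
  have h := (mem_opFeasible_chi g φ _).1 (isLeast_opFeasible_chi hd hg φ).1
  have hf : fCoeff g * ((d : ℝ) ^ 2 + 1) = 1 + RTop (thermalChi g) (chi g φ) := by
    rw [fCoeff, RTop_chi g 0 φ, div_mul_cancel₀]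
    positivity
  rw [hf]
  have h' := h.mul_mul_conjTranspose_same
    ((1 : Op (Fin 2)) ⊗ₖ realDiag fun p : Fin d × Fin d => (Real.sqrt (g p.1))⁻¹)
  refine posSemidef_of_eq h' ?_
  have hsq : ∀ i, (Real.sqrt (g i) : ℂ) * Real.sqrt (g i) = g i := fun i => by
    rw [← Complex.ofReal_mul, Real.mul_self_sqrt (hg i).le]
  have hne : ∀ i, (Real.sqrt (g i) : ℂ) ≠ 0 := fun i => by
    exact_mod_cast (Real.sqrt_pos.2 (hg i)).ne'
  have hV : (realDiag fun p : Fin d × Fin d => (Real.sqrt (g p.1))⁻¹).conjTranspose =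
      realDiag fun p : Fin d × Fin d => (Real.sqrt (g p.1))⁻¹ := isHermitian_realDiag _
  rw [Matrix.conjTranspose_kronecker, Matrix.mul_sub, Matrix.sub_mul, Matrix.mul_smul,
    Matrix.smul_mul, ← Matrix.mul_kronecker_mul, ← Matrix.mul_kronecker_mul,
    ← Matrix.mul_kronecker_mul, ← Matrix.mul_kronecker_mul, hV, Matrix.conjTranspose_one,
    Matrix.one_mul, Matrix.mul_one, Matrix.one_mul, Matrix.mul_one]
  congr 3
  · ext ⟨i, x⟩ ⟨j, y⟩
    simp only [realDiag, Matrix.mul_diagonal, Matrix.diagonal_apply]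
    split_ifs with hp
    · obtain ⟨rfl, rfl⟩ := Prod.mk.inj hp
      have := hne i
      simp only [sndWeight, prodWeight]
      push_cast
      rw [← hsq i]
      field_simp
    · simp
  · ext ⟨i, x⟩ ⟨j, y⟩
    have h1 := hne i
    have h2 := hne j
    have h3 := hne x
    have h4 := hne y
    simp only [realDiag, Matrix.diagonal_mul, Matrix.mul_diagonal, tau, Matrix.add_apply,
      Matrix.vecMulVec_apply, Pi.star_apply, Complex.star_def, sqrtVec, maxEntVec, hatVec, tfdVec]
    by_cases hx : i = x <;> by_cases hy : j = y <;> simp [hx, hy] <;> field_simp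
end Chi

/-! ### Joint robustness of the controlled channel -/

section Joint

variable {d : ℕ}

theorem sum_maxEntVec (g : Fin d → ℝ) :
    ∑ p, ‖maxEntVec d p‖ ^ 2 / sndWeight g p = ∑ i, (g i)⁻¹ := by
  rw [Fintype.sum_prod_type]
  refine Finset.sum_congr rfl fun i _ => ?_
  rw [Finset.sum_eq_single i (fun j _ hj => by simp [maxEntVec, hj.symm]) (by simp)]
  simp [maxEntVec, sndWeight]

theorem sum_sqrtVec {g : Fin d → ℝ} (hg : ∀ i, 0 < g i) :
    ∑ p, ‖sqrtVec g p‖ ^ 2 / sndWeight g p = (d : ℝ) ^ 2 := by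
  have : ∀ p, ‖sqrtVec g p‖ ^ 2 / sndWeight g p = 1 := fun p => by
    rw [sqrtVec, sndWeight, Complex.norm_real, Real.norm_eq_abs, sq_abs, Real.sq_sqrt (hg _).le,
      div_self (hg _).ne']
  rw [Finset.sum_congr rfl fun p _ => this p]
  simp [sq]

theorem sum_inv_pos (hd : 0 < d) {g : Fin d → ℝ} (hg : ∀ i, 0 < g i) : 0 < ∑ i, (g i)⁻¹ := by
  have : Nonempty (Fin d) := ⟨⟨0, hd⟩⟩
  exact Finset.sum_pos (fun i _ => inv_pos.2 (hg i)) Finset.univ_nonempty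

theorem isLeast_mapFeasible_G (hd : 0 < d) {g : Fin d → ℝ} (hg : ∀ i, 0 < g i) {s : ℝ}
    (hs1 : s ≤ 1) : IsLeast (mapFeasible {Gam g} (G g s)) ((1 - s) * (∑ i, (g i)⁻¹ - 1)) := by
  have hw : ∀ p, 0 < sndWeight g p := fun p => hg _
  have hz := sum_inv_pos hd hg
  have hmem : ∀ r, r ∈ mapFeasible {Gam g} (G g s) ↔ ((1 + r - s) • realDiag (sndWeight g) -
      (1 - s) • Matrix.vecMulVec (maxEntVec d) (star (maxEntVec d))).PosSemidef := by
    intro r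
    have h1 : choi (Gam g) = realDiag (sndWeight g) := by
      have := choi_G g 1
      simpa [G] using this
    rw [mapFeasible_singleton, opFeasible, Set.mem_ofPred_eq, OpLE, h1, choi_G]
    convert Iff.rfl using 2
    module
  constructor
  · rw [hmem]
    have h := posSemidef_smul_realDiag_sub_vecMulVec hw (sum_maxEntVec g).le
    refine posSemidef_of_eq (h.smul (sub_nonneg.2 hs1)) ?_
    module
  · intro r hr
    rw [hmem] at hr
    -- At s = 1 division by 1-s is impossible, but the rank-one term is absent and one diagonal
    -- entry gives r ≥ 0.
    rcases hs1.eq_or_lt with rfl | hlt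
    · have h := hr.diag_nonneg (i := (⟨0, hd⟩, ⟨0, hd⟩))
      simp only [realDiag, sub_self, zero_smul, sub_zero, Matrix.smul_apply,
        Matrix.diagonal_apply_eq, Complex.real_smul, add_sub_cancel_left] at h
      rw [← Complex.ofReal_mul, Complex.zero_le_real] at h
      simpa using nonneg_of_mul_nonneg_left h (hw _)
    · have hs : 0 < 1 - s := sub_pos.2 hlt
      have h1 : (((1 + r - s) / (1 - s)) • realDiag (sndWeight g) -
          Matrix.vecMulVec (maxEntVec d) (star (maxEntVec d))).PosSemidef := by
        refine posSemidef_of_eq (hr.smul (inv_pos.2 hs).le) ?_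
        rw [smul_sub, smul_smul, smul_smul, inv_mul_cancel₀ hs.ne', one_smul, div_eq_inv_mul]
      have h2 := sum_le_of_posSemidef_smul_realDiag_sub_vecMulVec hw
        (by rw [sum_maxEntVec]; exact hz) h1
      rw [sum_maxEntVec, le_div_iff₀ hs] at h2
      linarith

theorem realDiag_one_sub (α : ℝ) : (1 : Op (Fin 2)) - realDiag ![α, 1 - α] =
    realDiag ![1 - α, α] := by
  ext a b
  fin_cases a <;> fin_cases b <;> simp [realDiag]

theorem posSemidef_one_sub_qubit {α c : ℝ} (h0 : 0 ≤ α) (h1 : α ≤ 1) (hc0 : 0 ≤ c) (hc1 : c ≤ 1)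
    (φ : ℝ) : (realDiag ![1 - α, α] -
      (c * Real.sqrt (α * (1 - α))) • phaseFlip φ).PosSemidef := by
  rw [sub_eq_add_neg, ← neg_smul]
  refine posSemidef_qubit (sub_nonneg.2 h1) h0 ?_ φ
  have h : 0 ≤ α * (1 - α) := mul_nonneg h0 (sub_nonneg.2 h1)
  rw [neg_sq, mul_pow, Real.sq_sqrt h]
  nlinarith [mul_le_one₀ hc1 hc0 hc1]

/-- For this r, (1+r)/2 = s + (1-s)z + ½√(α(1-α)s(1-s)) f with z = ∑ 1/g_i. The summands pay for
`hA`, `hB` and `hC`: the aa† part with the thermal part, the ΩΩ† part, and the cross terms. -/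
theorem upper_mem_opFeasible (hd : 0 < d) {g : Fin d → ℝ} (hg : ∀ i, 0 < g i) {s : ℝ}
    (hs0 : 0 ≤ s) (hs1 : s ≤ 1) {α : ℝ} (h0 : 0 ≤ α) (h1 : α ≤ 1) (φ : ℝ) :
    1 + 2 * ((1 - s) * (∑ i, (g i)⁻¹ - 1)) + Real.sqrt (α * (1 - α) * s * (1 - s)) * fCoeff g ∈
      mapFeasible {traceReplace (Fin d) (thermalOut g)} (LamC g s α φ) := by
  rw [mapFeasible_singleton, opFeasible_choi_LamC, Set.mem_ofPred_eq,
    choi_LamC hd hg hs0 hs1 h0 h1]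
  have hw : ∀ p, 0 < sndWeight g p := fun p => hg _
  have hN := one_le_krausCard hd s
  have hd' : (0 : ℝ) < d := by exact_mod_cast hd
  have hW : (realDiag (sndWeight g)).PosSemidef :=
    Matrix.PosSemidef.diagonal fun p => by simpa using (hw p).le
  have hsqrt : Real.sqrt (α * (1 - α) * s * (1 - s)) =
      Real.sqrt (α * (1 - α)) * (Real.sqrt s * Real.sqrt (1 - s)) := by
    rw [mul_assoc, Real.sqrt_mul (mul_nonneg h0 (sub_nonneg.2 h1)), Real.sqrt_mul hs0]
  have hA : (s • ((1 - realDiag ![α, 1 - α]) ⊗ₖ realDiag (sndWeight g) -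
      ((((d : ℝ) ^ 2 * (krausCard d s)⁻¹) * Real.sqrt (α * (1 - α))) • phaseFlip φ) ⊗ₖ
        (((d : ℝ) ^ 2)⁻¹ • Matrix.vecMulVec (sqrtVec g) (star (sqrtVec g))))).PosSemidef := by
    -- The estimate needs d²/N ≤ 1, which can fail at s = 0, where N = 1; there the prefactor s
    -- vanishes.
    rcases hs0.eq_or_lt with rfl | hs
    · rw [zero_smul]
      exact Matrix.PosSemidef.zero
    · refine Matrix.PosSemidef.smul ?_ hs0
      rw [realDiag_one_sub]
      refine posSemidef_kronecker_sub_kronecker ?_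
        (posSemidef_one_sub_qubit h0 h1 (by positivity) ?_ φ)
        ((Matrix.posSemidef_vecMulVec_self_star _).smul (by positivity)) ?_
      · have := posSemidef_one_sub_qubit h0 h1 le_rfl zero_le_one φ
        simpa using this
      · rw [← div_eq_mul_inv, div_le_one (by linarith), krausCard, if_neg hs.ne']
        split_ifs <;> linarith
      · have := posSemidef_smul_realDiag_sub_vecMulVec hw (sum_sqrtVec hg).le
        refine posSemidef_of_eq (this.smul (a := ((d : ℝ) ^ 2)⁻¹) (by positivity)) ?_
        rw [smul_sub, smul_smul, inv_mul_cancel₀ (by positivity), one_smul]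
  have hB : ((1 - s) • ((1 : Op (Fin 2)) ⊗ₖ ((∑ i, (g i)⁻¹) • realDiag (sndWeight g)) -
      (realDiag ![α, 1 - α] + ((krausCard d s)⁻¹ * Real.sqrt (α * (1 - α))) • phaseFlip φ) ⊗ₖ
        Matrix.vecMulVec (maxEntVec d) (star (maxEntVec d)))).PosSemidef := by
    refine Matrix.PosSemidef.smul ?_ (sub_nonneg.2 hs1)
    refine posSemidef_kronecker_sub_kronecker Matrix.PosSemidef.one ?_
      (Matrix.posSemidef_vecMulVec_self_star _)
      (posSemidef_smul_realDiag_sub_vecMulVec hw (sum_maxEntVec g).le)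
    rw [← sub_sub, realDiag_one_sub]
    exact posSemidef_one_sub_qubit h0 h1 (by positivity) (inv_le_one_of_one_le₀ hN) φ
  have hC : (((krausCard d s)⁻¹ * Real.sqrt (α * (1 - α)) * (Real.sqrt s * Real.sqrt (1 - s))) •
      ((fCoeff g * krausCard d s / 2) • ((1 : Op (Fin 2)) ⊗ₖ realDiag (sndWeight g)) -
      phaseFlip φ ⊗ₖ (Matrix.vecMulVec (sqrtVec g) (star (maxEntVec d)) +
        Matrix.vecMulVec (maxEntVec d) (star (sqrtVec g))))).PosSemidef := by
    -- The normalisation in f matches N = d²+1 only for 0 < s < 1; at the endpoints there are no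
    -- cross terms.
    by_cases hs : s = 0 ∨ s = 1
    · have : Real.sqrt s * Real.sqrt (1 - s) = 0 := by
        rcases hs with rfl | rfl <;> simp
      rw [this, mul_zero, zero_smul]
      exact Matrix.PosSemidef.zero
    · rw [not_or] at hs
      refine Matrix.PosSemidef.smul ?_ (by positivity)
      have : krausCard d s = (d : ℝ) ^ 2 + 1 := by
        rw [krausCard, if_neg hs.1, if_neg hs.2, add_comm]
      rw [this]
      exact posSemidef_sub_cross hd hg φ
  refine posSemidef_of_eq ((hA.add hB).add hC) ?_
  rw [hsqrt]
  have e1 : (Real.sqrt s : ℂ) * Real.sqrt s = s := by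
    rw [← Complex.ofReal_mul, Real.mul_self_sqrt hs0]
  have e2 : (Real.sqrt (1 - s) : ℂ) * Real.sqrt (1 - s) = 1 - s := by
    rw [← Complex.ofReal_mul, Real.mul_self_sqrt (sub_nonneg.2 hs1)]
    push_cast
    ring
  have e3 : (krausCard d s : ℂ) ≠ 0 := by
    have : krausCard d s ≠ 0 := by linarith
    exact_mod_cast this
  have e4 : (d : ℂ) ≠ 0 := by exact_mod_cast hd.ne'
  ext ⟨a, i⟩ ⟨b, j⟩
  simp only [Matrix.sub_apply, Matrix.add_apply, Matrix.smul_apply, Matrix.kroneckerMap_apply,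
    Complex.real_smul, Matrix.vecMulVec_apply, Pi.star_apply, Pi.add_apply, Pi.smul_apply,
    star_add, Complex.star_def, map_mul, Complex.conj_ofReal]
  push_cast
  generalize (1 : Op (Fin 2)) a b = o
  generalize phaseFlip φ a b = f
  generalize realDiag ![α, 1 - α] a b = D
  generalize realDiag (sndWeight g) i j = W
  generalize (starRingEnd ℂ) (sqrtVec g j) = A'
  generalize sqrtVec g i = A
  generalize (starRingEnd ℂ) (maxEntVec d j) = O'
  generalize maxEntVec d i = O
  generalize (Real.sqrt s : ℂ) = rs at *
  generalize (Real.sqrt (1 - s) : ℂ) = rt at *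
  generalize (Real.sqrt (α * (1 - α)) : ℂ) = q
  generalize (krausCard d s : ℂ) = N at *
  field_simp
  linear_combination (-2 * q * f * A * A') * e1 + (-2 * q * f * O * O') * e2

end Joint

/-! ### Lower bounds -/

section Lower

variable {d : ℕ}

theorem posSemidef_compress_kronecker {κ n : Type} [Fintype κ] [Fintype n] {P Q S : Op κ}
    {A B C : Op n} (h : (P ⊗ₖ A - (Q ⊗ₖ B + S ⊗ₖ C)).PosSemidef) (u : n → ℂ) :
    ((star u ⬝ᵥ A.mulVec u) • P -
      ((star u ⬝ᵥ B.mulVec u) • Q + (star u ⬝ᵥ C.mulVec u) • S)).PosSemidef := by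
  have h1 := posSemidef_compress (h.submatrix Prod.swap) u
  refine posSemidef_of_eq h1 ?_
  ext a b
  simp only [Matrix.sub_apply, Matrix.add_apply, Matrix.smul_apply, Matrix.kroneckerMap_apply,
    Matrix.of_apply, Matrix.submatrix_apply, Prod.swap_prod_mk, smul_eq_mul, dotProduct,
    Matrix.mulVec, Finset.mul_sum, Finset.sum_mul, Pi.star_apply, ← Finset.sum_add_distrib,
    ← Finset.sum_sub_distrib]
  refine Finset.sum_congr rfl fun i _ => Finset.sum_congr rfl fun j _ => ?_
  ring

/-- Compressing the target by W⁻¹v turns W into L and vv† into L², leaving a qubit matrix. -/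
theorem bounds_of_posSemidef_kronecker {n : Type} [Fintype n] [DecidableEq n] {w : n → ℝ}
    (hw : ∀ i, 0 < w i) {v : n → ℂ} {L : ℝ} (hL : ∑ i, ‖v i‖ ^ 2 / w i = L) {M : Op n} {m : ℝ}
    (hm : star (fun i => v i / (w i : ℂ)) ⬝ᵥ M.mulVec (fun i => v i / (w i : ℂ)) = (m : ℂ))
    {κ α c φ : ℝ} (h : (κ • ((1 : Op (Fin 2)) ⊗ₖ realDiag w) - (realDiag ![α, 1 - α] ⊗ₖ M +
      c • (phaseFlip φ ⊗ₖ Matrix.vecMulVec v (star v)))).PosSemidef) :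
    0 ≤ κ * L - m * α ∧ 0 ≤ κ * L - m * (1 - α) ∧
      (c * L ^ 2) ^ 2 ≤ (κ * L - m * α) * (κ * L - m * (1 - α)) := by
  rw [← Matrix.smul_kronecker, ← Matrix.smul_kronecker] at h
  have h1 := posSemidef_compress_kronecker h fun i => v i / (w i : ℂ)
  rw [dotProduct_realDiag_mulVec_div hw, dotProduct_vecMulVec_mulVec_div hw, hm, hL] at h1
  have h2 : (realDiag ![κ * L - m * α, κ * L - m * (1 - α)] +
      (-(c * L ^ 2)) • phaseFlip φ).PosSemidef := by
    refine posSemidef_of_eq h1 ?_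
    ext a b
    fin_cases a <;> fin_cases b <;> simp [realDiag, phaseFlip] <;> ring
  simpa using qubit_bounds_of_posSemidef h2

/-- The product expands to κ² - mκ + m²α(1-α), so `hc` says mκ ≤ κ²; adding `hp` and `hq` gives κ >
0. -/
theorem le_of_qubit_bounds {κ m α : ℝ} (hm : 0 < m) (hp : 0 ≤ κ - m * α)
    (hq : 0 ≤ κ - m * (1 - α))
    (hc : m ^ 2 * (α * (1 - α)) ≤ (κ - m * α) * (κ - m * (1 - α))) : m ≤ κ := by
  have h1 : 0 < κ := by linarith
  have h2 : κ * m ≤ κ * κ := by linarith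
  exact le_of_mul_le_mul_left h2 h1

theorem le_of_mem_mapFeasible_zero (hd : 0 < d) {g : Fin d → ℝ} (hg : ∀ i, 0 < g i)
    {α : ℝ} (h0 : 0 ≤ α) (h1 : α ≤ 1) {φ r : ℝ}
    (hr : r ∈ mapFeasible {traceReplace (Fin d) (thermalOut g)} (LamC g 0 α φ)) :
    2 * ∑ i, (g i)⁻¹ - 1 ≤ r := by
  rw [mapFeasible_singleton, opFeasible_choi_LamC, Set.mem_ofPred_eq,
    choi_LamC hd hg le_rfl zero_le_one h0 h1] at hr
  simp only [krausCard, zero_ne_one, if_false, if_true, Real.sqrt_zero, sub_zero, Real.sqrt_one,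
    zero_smul, one_smul, zero_add, add_zero, inv_one, one_mul] at hr
  have hz := sum_inv_pos hd hg
  have hw : ∀ p, 0 < sndWeight g p := fun p => hg _
  obtain ⟨hp, hq, hc⟩ := bounds_of_posSemidef_kronecker hw
    (sum_maxEntVec g) (m := (∑ i, (g i)⁻¹) ^ 2)
    ((dotProduct_vecMulVec_mulVec_div hw _).trans (by rw [sum_maxEntVec])) hr
  generalize ∑ i, (g i)⁻¹ = z at *
  have hsq := Real.sq_sqrt (mul_nonneg h0 (sub_nonneg.2 h1))
  have e1 : (1 + r) / 2 * z - z ^ 2 * α = z * ((1 + r) / 2 - z * α) := by ring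
  have e2 : (1 + r) / 2 * z - z ^ 2 * (1 - α) = z * ((1 + r) / 2 - z * (1 - α)) := by ring
  rw [e1] at hp hc
  rw [e2] at hq hc
  have := le_of_qubit_bounds hz (nonneg_of_mul_nonneg_right hp hz)
    (nonneg_of_mul_nonneg_right hq hz) (by
      refine le_of_mul_le_mul_left (a := z ^ 2) ?_ (by positivity)
      rw [mul_pow, hsq] at hc
      linarith)
  linarith

theorem le_of_mem_mapFeasible_one (hd : 0 < d) {g : Fin d → ℝ} (hg : ∀ i, 0 < g i)
    {α : ℝ} (h0 : 0 ≤ α) (h1 : α ≤ 1) {φ r : ℝ}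
    (hr : r ∈ mapFeasible {traceReplace (Fin d) (thermalOut g)} (LamC g 1 α φ)) : 1 ≤ r := by
  rw [mapFeasible_singleton, opFeasible_choi_LamC, Set.mem_ofPred_eq,
    choi_LamC hd hg zero_le_one le_rfl h0 h1] at hr
  simp only [krausCard, one_ne_zero, if_false, if_true, Real.sqrt_zero, sub_self, Real.sqrt_one,
    zero_smul, one_smul, zero_add, add_zero] at hr
  have hd' : (0 : ℝ) < d := by exact_mod_cast hd
  have hw : ∀ p, 0 < sndWeight g p := fun p => hg _
  obtain ⟨hp, hq, hc⟩ := bounds_of_posSemidef_kronecker hw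
    (sum_sqrtVec hg) (m := (d : ℝ) ^ 2)
    ((dotProduct_realDiag_mulVec_div hw _).trans (by rw [sum_sqrtVec hg])) hr
  have hz : (0 : ℝ) < (d : ℝ) ^ 2 := by positivity
  generalize (d : ℝ) ^ 2 = z at *
  have hsq := Real.sq_sqrt (mul_nonneg h0 (sub_nonneg.2 h1))
  have e1 : (1 + r) / 2 * z - z * α = z * ((1 + r) / 2 - 1 * α) := by ring
  have e2 : (1 + r) / 2 * z - z * (1 - α) = z * ((1 + r) / 2 - 1 * (1 - α)) := by ring
  have e3 : (z⁻¹ * Real.sqrt (α * (1 - α)) * z ^ 2) ^ 2 = z ^ 2 * (α * (1 - α)) := by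
    have : z⁻¹ * Real.sqrt (α * (1 - α)) * z ^ 2 = z * Real.sqrt (α * (1 - α)) := by field_simp
    rw [this, mul_pow, hsq]
  rw [e1] at hp hc
  rw [e2] at hq hc
  rw [e3] at hc
  have := le_of_qubit_bounds one_pos (nonneg_of_mul_nonneg_right hp hz)
    (nonneg_of_mul_nonneg_right hq hz) (by
      refine le_of_mul_le_mul_left (a := z ^ 2) ?_ (by positivity)
      linarith)
  linarith

/-! ### Athermality for completely thermalising inputs -/

theorem smul_thermalOut (g : Fin d → ℝ) (r : ℝ) : r • thermalOut g =
    (r / 2) • ((1 : Op (Fin 2)) ⊗ₖ realDiag g) := by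
  rw [thermalOut, thermalC, Matrix.smul_kronecker]
  ext a b
  simp only [Matrix.smul_apply, Complex.real_smul, smul_eq_mul, thermal, realDiag]
  push_cast
  ring

/-- Here ∑ K = |√g⟩⟨1| with 1 the all-ones vector, and ⟨1|γ|1⟩ = Tr γ = 1. -/
theorem LamC_one_thermal (hd : 0 < d) {g : Fin d → ℝ} (hg : ∀ i, 0 < g i) (hsum : ∑ i, g i = 1)
    {α : ℝ} (h0 : 0 ≤ α) (h1 : α ≤ 1) (φ : ℝ) :
    LamC g 1 α φ (thermal g) = realDiag ![α, 1 - α] ⊗ₖ realDiag g +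
      (((d : ℝ) ^ 2)⁻¹ * Real.sqrt (α * (1 - α))) • (phaseFlip φ ⊗ₖ
        Matrix.vecMulVec (fun i => (Real.sqrt (g i) : ℂ))
          (star fun i => (Real.sqrt (g i) : ℂ))) := by
  classical
  have hsumC : ∑ i, (g i : ℂ) = 1 := by exact_mod_cast hsum
  rw [LamC_apply hd hg zero_le_one le_rfl h0 h1, sum_krausG]
  congr 2
  · simp [G, Gam, traceReplace, thermal, realDiag, hsumC]
  · simp [krausCard]
  · congr 1
    ext x y
    simp [Matrix.mul_apply, Matrix.vecMulVec_apply, thermal, Matrix.diagonal_apply, ← Finset.mul_sum,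
      ← Finset.sum_mul, hsumC]

/-- With κ = (1+r)/2, the critical equation (κ-α)(κ-1+α) = α(1-α)/d² reads r² = (1-2α)² +
4α(1-α)/d². -/
theorem isLeast_opFeasible_LamC_one (hd : 0 < d) {g : Fin d → ℝ} (hg : ∀ i, 0 < g i)
    (hsum : ∑ i, g i = 1) {α : ℝ} (h0 : 0 ≤ α) (h1 : α ≤ 1) (φ : ℝ) :
    IsLeast (opFeasible (thermalOut g) (LamC g 1 α φ (thermal g)))
      (Real.sqrt ((1 - 2 * α) ^ 2 + 4 * ((d : ℝ) ^ 2)⁻¹ * (α * (1 - α)))) := by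
  have hd' : (0 : ℝ) < d := by exact_mod_cast hd
  have hα : 0 ≤ α * (1 - α) := mul_nonneg h0 (sub_nonneg.2 h1)
  have hL : ∑ i, ‖(Real.sqrt (g i) : ℂ)‖ ^ 2 / g i = d := by
    have : ∀ i, ‖(Real.sqrt (g i) : ℂ)‖ ^ 2 / g i = 1 := fun i => by
      rw [Complex.norm_real, Real.norm_eq_abs, sq_abs, Real.sq_sqrt (hg _).le,
        div_self (hg _).ne']
    rw [Finset.sum_congr rfl fun i _ => this i]
    simp
  have hsq := Real.sq_sqrt hα
  have hmem : ∀ r, r ∈ opFeasible (thermalOut g) (LamC g 1 α φ (thermal g)) ↔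
      (((1 + r) / 2) • ((1 : Op (Fin 2)) ⊗ₖ realDiag g) - (realDiag ![α, 1 - α] ⊗ₖ realDiag g +
      (((d : ℝ) ^ 2)⁻¹ * Real.sqrt (α * (1 - α))) • (phaseFlip φ ⊗ₖ
        Matrix.vecMulVec (fun i => (Real.sqrt (g i) : ℂ))
          (star fun i => (Real.sqrt (g i) : ℂ))))).PosSemidef := by
    intro r
    rw [opFeasible, Set.mem_ofPred_eq, OpLE, smul_thermalOut, LamC_one_thermal hd hg hsum h0 h1]
  constructor
  · rw [hmem]
    set r := Real.sqrt ((1 - 2 * α) ^ 2 + 4 * ((d : ℝ) ^ 2)⁻¹ * (α * (1 - α))) with hr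
    have hr2 : r ^ 2 = (1 - 2 * α) ^ 2 + 4 * ((d : ℝ) ^ 2)⁻¹ * (α * (1 - α)) :=
      Real.sq_sqrt (by positivity)
    have hrabs : |1 - 2 * α| ≤ r := Real.abs_le_sqrt (le_add_of_nonneg_right (by positivity))
    rw [abs_le] at hrabs
    have hP : 0 ≤ (1 + r) / 2 - α := by linarith
    have hQ : 0 ≤ (1 + r) / 2 - (1 - α) := by linarith
    -- The factor d⁻² is shared evenly: one d⁻¹ makes |√g⟩⟨√g| at most γ, the other enters the qubit
    -- determinant.
    have key : (realDiag ![(1 + r) / 2 - α, (1 + r) / 2 - (1 - α)] ⊗ₖ realDiag g -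
        ((((d : ℝ))⁻¹ * Real.sqrt (α * (1 - α))) • phaseFlip φ) ⊗ₖ
          (((d : ℝ))⁻¹ • Matrix.vecMulVec (fun i => (Real.sqrt (g i) : ℂ))
            (star fun i => (Real.sqrt (g i) : ℂ)))).PosSemidef := by
      refine posSemidef_kronecker_sub_kronecker ?_ ?_
        ((Matrix.posSemidef_vecMulVec_self_star _).smul (by positivity)) ?_
      · have := posSemidef_qubit (c := 0) hP hQ (by simpa using mul_nonneg hP hQ) φ
        simpa using this
      · rw [sub_eq_add_neg, ← neg_smul]
        refine posSemidef_qubit hP hQ (le_of_eq ?_) φ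
        rw [neg_sq, mul_pow, hsq]
        rw [inv_pow]
        linear_combination (-1 / 4 : ℝ) * hr2
      · have := posSemidef_smul_realDiag_sub_vecMulVec hg hL.le
        refine posSemidef_of_eq (this.smul (a := (d : ℝ)⁻¹) (by positivity)) ?_
        rw [smul_sub, smul_smul, inv_mul_cancel₀ hd'.ne', one_smul]
    refine posSemidef_of_eq key ?_
    have hD : realDiag ![(1 + r) / 2 - α, (1 + r) / 2 - (1 - α)] =
        ((1 + r) / 2) • (1 : Op (Fin 2)) - realDiag ![α, 1 - α] := by
      ext a b
      fin_cases a <;> fin_cases b <;> simp [realDiag]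
    rw [hD]
    ext ⟨a, i⟩ ⟨b, j⟩
    simp only [Matrix.sub_apply, Matrix.add_apply, Matrix.smul_apply, Matrix.kroneckerMap_apply,
      Complex.real_smul]
    push_cast
    ring
  · intro r hr
    rw [hmem] at hr
    obtain ⟨hp, hq, hc⟩ := bounds_of_posSemidef_kronecker hg hL
      ((dotProduct_realDiag_mulVec_div hg _).trans (congrArg _ hL)) hr
    have hr0 : 0 ≤ r := by
      have : 0 ≤ d * r := by linarith
      exact nonneg_of_mul_nonneg_right this hd'
    refine Real.sqrt_le_iff.2 ⟨hr0, ?_⟩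
    have e : (((d : ℝ) ^ 2)⁻¹ * Real.sqrt (α * (1 - α)) * (d : ℝ) ^ 2) ^ 2 = α * (1 - α) := by
      rw [mul_right_comm, inv_mul_cancel₀ (by positivity), one_mul, hsq]
    rw [e] at hc
    have h4 : 4 * ((d : ℝ) ^ 2)⁻¹ * (α * (1 - α)) ≤ r ^ 2 - (1 - 2 * α) ^ 2 := by
      rw [mul_right_comm, ← div_eq_mul_inv, div_le_iff₀ (by positivity)]
      linarith
    linarith

/-! ### Signalling -/

/-- (1+rs)σ - Λ(γ) is positive with trace rs, hence at most (rs/b)W, while Λ(γ) ≤ (1+rt)W; so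
(1+rs)σ ≤ (1+rt+rs/b)W. -/
theorem add_div_mem_mapFeasible {m : Type} [Fintype m] [DecidableEq m] {w : m → ℝ} {b : ℝ}
    (hb : 0 < b) (hw : ∀ i, b ≤ w i) {γ : Op (Fin d)} (hγ : IsState γ)
    {Λ : SuperOp (Fin d) m} (hΛ : IsChannel Λ) {rs rt : ℝ}
    (hs : rs ∈ mapFeasible (NSO (Fin d) m) Λ) (ht : rt ∈ opFeasible (realDiag w) (Λ γ)) :
    rt + rs / b ∈ mapFeasible {traceReplace (Fin d) (realDiag w)} Λ := by
  obtain ⟨_, ⟨σ, hσ, rfl⟩, h⟩ := hs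
  have hM := IsCP.posSemidef_apply h hγ.1
  have e : ((1 + rs) • traceReplace (Fin d) σ - Λ) γ = (1 + rs) • σ - Λ γ := by
    rw [LinearMap.sub_apply, LinearMap.smul_apply, traceReplace, LinearMap.smulRight_apply,
      Matrix.traceLinearMap_apply, hγ.2, one_smul]
  rw [e] at hM
  have htr : ((1 + rs) • σ - Λ γ).trace.re = rs := by
    rw [Matrix.trace_sub, Matrix.trace_smul, hσ.2, hΛ.2, hγ.2]
    simp
  have hle := posSemidef_smul_realDiag_sub hM hb hw (t := rs / b)
    (by rw [htr, div_mul_cancel₀ _ hb.ne'])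
  have ht : ((1 + rt) • realDiag w - Λ γ).PosSemidef := ht
  have h1 := (Matrix.PosSemidef.one (n := Fin d) (R := ℂ)).kronecker (ht.add hle)
  have h2 := (isCP_iff_posSemidef_choi _).1 h
  rw [choi_sub, choi_smul, choi_traceReplace] at h2
  rw [mapFeasible_singleton, opFeasible, Set.mem_ofPred_eq, OpLE, choi_traceReplace]
  refine posSemidef_of_eq (h1.add h2) ?_
  ext p q
  simp only [Matrix.sub_apply, Matrix.add_apply, Matrix.smul_apply, Matrix.kroneckerMap_apply,
    Complex.real_smul]
  push_cast
  ring

/-- A priori bound from the trace d of the Choi matrix and the least weight b. -/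
theorem div_sub_one_mem_mapFeasible {m : Type} [Fintype m] [DecidableEq m] {w : m → ℝ} {b : ℝ}
    (hb : 0 < b) (hw : ∀ i, b ≤ w i) {Λ : SuperOp (Fin d) m} (hΛ : IsChannel Λ) :
    (d : ℝ) / b - 1 ∈ mapFeasible {traceReplace (Fin d) (realDiag w)} Λ := by
  have h := posSemidef_smul_realDiag_sub ((isCP_iff_posSemidef_choi _).1 hΛ.1)
    (w := fun p => w p.2) hb (fun p => hw _) (t := (d : ℝ) / b)
    (by rw [trace_choi hΛ.2, div_mul_cancel₀ _ hb.ne']; simp)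
  rw [mapFeasible_singleton, opFeasible, Set.mem_ofPred_eq, OpLE, choi_traceReplace]
  refine posSemidef_of_eq h ?_
  rw [add_sub_cancel]
  congr 2
  ext ⟨i, x⟩ ⟨j, y⟩
  by_cases hij : i = j <;> by_cases hxy : x = y <;> simp [realDiag, hij, hxy]

/-- One factor r - rt is bounded by 2rs/b, the other by b⁻³; b/2 is the least weight of the output
thermal state. -/
theorem pow_four_mul_sq_le {n : ℕ} {b r rt rs : ℝ} (hb : 0 < b) (hn : 1 ≤ n) (hnb : n * b ≤ 1)
    (hrt : 0 ≤ rt) (hle : rt ≤ r) (hr : r ≤ n / (b / 2) - 1) (hrs : r ≤ rt + rs / (b / 2)) :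
    b ^ 4 / 2 * (r - rt) ^ 2 ≤ rs := by
  have h1 : b * (r - rt) ≤ 2 * rs := by
    have : b * (r - rt) ≤ b * (rs / (b / 2)) := mul_le_mul_of_nonneg_left (by linarith) hb.le
    calc b * (r - rt) ≤ b * (rs / (b / 2)) := this
      _ = 2 * rs := by field_simp
  have h2 : b * r ≤ 2 * n - b := by
    calc b * r ≤ b * (n / (b / 2) - 1) := mul_le_mul_of_nonneg_left hr hb.le
      _ = 2 * n - b := by field_simp
  have h3 : b ^ 3 * (r - rt) ≤ 1 := by
    have h4 : b ^ 3 * (r - rt) ≤ b ^ 2 * (2 * n - b) := by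
      calc b ^ 3 * (r - rt) ≤ b ^ 3 * r := mul_le_mul_of_nonneg_left (by linarith) (by positivity)
        _ = b ^ 2 * (b * r) := by ring
        _ ≤ _ := mul_le_mul_of_nonneg_left h2 (by positivity)
    refine h4.trans ?_
    -- For n ≥ 2, nb ≤ 1 gives b²(2n-b) ≤ 2b ≤ 1. For n = 1, b may exceed 1/2, and 1 - b²(2-b) =
    -- (1-b)(1+b-b²) ≥ 0 is used.
    rcases hn.eq_or_lt with rfl | hn2
    · push_cast at hnb ⊢
      nlinarith [mul_nonneg hb.le (sq_nonneg (1 - b)), sq_nonneg (1 - b)]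
    · have hn3 : (2 : ℝ) ≤ n := by exact_mod_cast hn2
      have hb2 : b ≤ 1 / 2 := by nlinarith
      nlinarith [pow_pos hb 3]
  calc b ^ 4 / 2 * (r - rt) ^ 2 = (b ^ 3 * (r - rt)) * (b * (r - rt)) / 2 := by ring
    _ ≤ 1 * (b * (r - rt)) / 2 := by
      have : 0 ≤ b * (r - rt) := mul_nonneg hb.le (sub_nonneg.2 hle)
      gcongr
    _ ≤ rs := by linarith

end Lower

/-! ### Thermal states as states, and assembly of the theorem. -/

variable {d : ℕ}

theorem isState_thermal {g : Fin d → ℝ} (hg : ∀ i, 0 < g i) (hsum : ∑ i, g i = 1) :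
    IsState (thermal g) := by
  refine ⟨Matrix.PosSemidef.diagonal fun i => by simpa using (hg i).le, ?_⟩
  rw [thermal, Matrix.trace_diagonal]
  exact_mod_cast hsum

theorem thermalOut_eq_realDiag (g : Fin d → ℝ) :
    thermalOut g = realDiag fun p : Fin 2 × Fin d => g p.2 / 2 := by
  ext ⟨i, x⟩ ⟨j, y⟩
  by_cases hij : i = j <;> by_cases hxy : x = y <;>
    simp [thermalOut, thermalC, thermal, realDiag, hij, hxy]
  ring

theorem isState_thermalOut {g : Fin d → ℝ} (hg : ∀ i, 0 < g i) (hsum : ∑ i, g i = 1) :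
    IsState (thermalOut g) := by
  refine ⟨?_, ?_⟩
  · rw [thermalOut_eq_realDiag]
    exact Matrix.PosSemidef.diagonal fun p => by
      have := (hg p.2).le
      simp only [Pi.zero_apply, Complex.zero_le_real]
      positivity
  · rw [thermalOut, Matrix.trace_kronecker, (isState_thermal hg hsum).2]
    simp [thermalC]

end CoherentControl
end

open CoherentControl in
theorem mainTheorem10 (d : ℕ) (g : Fin d → ℝ) (hg_pos : ∀ i, 0 < g i) (hg_sum : ∑ i, g i = 1) :
    -- `f(γ)` is positive, and its defining expression does not depend on the phase of `χ`
    0 < fCoeff g ∧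
    (∀ φ : ℝ,
      IsLeast (opFeasible (thermalChi g) (chi g φ)) (RTop (thermalChi g) (chi g φ)) ∧
      (1 + RTop (thermalChi g) (chi g φ)) / ((d : ℝ) ^ 2 + 1) = fCoeff g) ∧
    ∀ s ∈ Set.Icc (0 : ℝ) 1, ∀ α ∈ Set.Icc (0 : ℝ) 1, ∀ φ : ℝ,
      -- all minima that define the measures below are attained
      IsLeast (opFeasible thermalC (controlState α φ)) (RTop thermalC (controlState α φ)) ∧
      IsLeast (mapFeasible {Gam g} (G g s)) (R (thermal g) (G g s)) ∧
      IsLeast (mapFeasible {traceReplace (Fin d) (thermalOut g)} (LamC g s α φ))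
        (R (thermalOut g) (LamC g s α φ)) ∧
      IsLeast (mapFeasible (GPO (thermal g) (thermalOut g)) (LamC g s α φ))
        (RT (thermal g) (thermalOut g) (LamC g s α φ)) ∧
      IsLeast (mapFeasible (NSO (Fin d) (Fin 2 × Fin d)) (LamC g s α φ))
        (RS (LamC g s α φ)) ∧
      RTop thermalC (controlState α φ) = 1 ∧
      -- upper bound
      R (thermalOut g) (LamC g s α φ) ≤
        RTop thermalC (controlState α φ) + 2 * R (thermal g) (G g s) +
          Real.sqrt (α * (1 - α) * s * (1 - s)) * fCoeff g ∧
      -- saturation of the upper bound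
      (s = 0 ∨ s = 1 →
        R (thermalOut g) (LamC g s α φ) =
          RTop thermalC (controlState α φ) + 2 * R (thermal g) (G g s) +
            Real.sqrt (α * (1 - α) * s * (1 - s)) * fCoeff g) ∧
      -- lower bounds
      RS (LamC g s α φ) ≤ R (thermalOut g) (LamC g s α φ) ∧
      ((⨅ i, g i) ^ 4 / 2) *
          (R (thermalOut g) (LamC g s α φ) - RT (thermal g) (thermalOut g) (LamC g s α φ)) ^ 2 ≤
        RS (LamC g s α φ) ∧
      -- the value of the athermality for completely thermalising inputs
      (s = 1 →
        RT (thermal g) (thermalOut g) (LamC g s α φ) =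
          Real.sqrt ((1 - 2 * α) ^ 2 + 4 * ((d : ℝ) ^ 2)⁻¹ * (α * (1 - α)))) := by
  have hd : 0 < d := by
    rcases Nat.eq_zero_or_pos d with rfl | h
    · simp at hg_sum
    · exact h
  refine ⟨fCoeff_pos hd hg_pos, fun φ => ⟨isLeast_opFeasible_chi hd hg_pos φ, ?_⟩, ?_⟩
  · rw [RTop_chi g φ 0, fCoeff]
  rintro s ⟨hs0, hs1⟩ α ⟨h0, h1⟩ φ
  have hΛ := isChannel_LamC hd hg_pos hg_sum hs0 hs1 h0 h1 φ
  have hγ := isState_thermal hg_pos hg_sum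
  have hout := isState_thermalOut hg_pos hg_sum
  have hC := isLeast_opFeasible_controlState h0 h1 φ
  have hRC : RTop thermalC (controlState α φ) = 1 := hC.csInf_eq
  have hG := isLeast_mapFeasible_G hd hg_pos hs1
  have hRG : R (thermal g) (G g s) = (1 - s) * (∑ i, (g i)⁻¹ - 1) := hG.csInf_eq
  have hup := upper_mem_opFeasible hd hg_pos hs0 hs1 h0 h1 φ
  have hNSO : traceReplace (Fin d) (thermalOut g) ∈ NSO (Fin d) (Fin 2 × Fin d) :=
    ⟨_, hout, rfl⟩
  have hGPO : traceReplace (Fin d) (thermalOut g) ∈ GPO (thermal g) (thermalOut g) :=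
    ⟨isChannel_traceReplace hout, by simp [traceReplace, hγ.2]⟩
  -- The thermal replacement channel is both non-signalling and Gibbs-preserving, so `R` dominates
  -- `RS` and `RT`.
  have hmono : ∀ F : Set (SuperOp (Fin d) (Fin 2 × Fin d)),
      traceReplace (Fin d) (thermalOut g) ∈ F → ∀ r,
      r ∈ mapFeasible {traceReplace (Fin d) (thermalOut g)} (LamC g s α φ) →
      r ∈ mapFeasible F (LamC g s α φ) := by
    rintro F hF r ⟨Z, hZ, h⟩
    rw [Set.mem_singleton_iff] at hZ
    exact ⟨Z, hZ ▸ hF, h⟩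
  have hGPOtr : ∀ Z ∈ GPO (thermal g) (thermalOut g), ∀ X, (Z X).trace = X.trace :=
    fun Z hZ => hZ.1.2
  have hR : IsLeast (mapFeasible {traceReplace (Fin d) (thermalOut g)} (LamC g s α φ))
      (R (thermalOut g) (LamC g s α φ)) := by
    have hnn : ∀ r ∈ mapFeasible {traceReplace (Fin d) (thermalOut g)} (LamC g s α φ), 0 ≤ r :=
      fun r hr => nonneg_of_mapFeasible hGPOtr hΛ.2 hd (hmono _ hGPO r hr)
    have hup' := hup
    rw [R]
    rw [mapFeasible_singleton] at hnn hup' ⊢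
    exact isLeast_opFeasible ⟨_, hup'⟩ hnn
  have hRTmem := hmono _ hGPO _ hR.1
  have hRT : IsLeast (mapFeasible (GPO (thermal g) (thermalOut g)) (LamC g s α φ))
      (RT (thermal g) (thermalOut g) (LamC g s α φ)) := by
    have hnn : ∀ r ∈ mapFeasible (GPO (thermal g) (thermalOut g)) (LamC g s α φ), 0 ≤ r :=
      fun r hr => nonneg_of_mapFeasible hGPOtr hΛ.2 hd hr
    rw [RT]
    rw [mapFeasible_GPO hγ hout hΛ] at hnn hRTmem ⊢
    exact isLeast_opFeasible ⟨_, hRTmem⟩ hnn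
  have hRS := isLeast_mapFeasible_NSO hΛ.2 hd (hmono _ hNSO _ hR.1)
  have hle := hR.2 hup
  refine ⟨by rwa [hRC], by rwa [hRG], hR, hRT, hRS, hRC, ?_, ?_, ?_, ?_, ?_⟩
  · rw [hRC, hRG]
    exact hle
  · intro hs
    rw [hRC, hRG]
    refine hle.antisymm ?_
    rcases hs with rfl | rfl
    · have := le_of_mem_mapFeasible_zero hd hg_pos h0 h1 hR.1
      simp only [mul_zero, zero_mul, Real.sqrt_zero, sub_zero, one_mul]
      linarith
    · have := le_of_mem_mapFeasible_one hd hg_pos h0 h1 hR.1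
      simpa using this
  · exact hRS.2 (hmono _ hNSO _ hR.1)
  · have : Nonempty (Fin d) := ⟨⟨0, hd⟩⟩
    have hmin : ∀ i, (⨅ i, g i) ≤ g i := fun i => ciInf_le (Set.finite_range g).bddBelow i
    have hb : 0 < ⨅ i, g i := by
      obtain ⟨i, hi⟩ := exists_eq_ciInf_of_finite (f := g)
      rw [← hi]
      exact hg_pos i
    have hnb : d * (⨅ i, g i) ≤ 1 := by
      rw [← hg_sum]
      simpa using Finset.card_nsmul_le_sum (Finset.univ : Finset (Fin d)) g _ fun i _ => hmin i
    have hw : ∀ p : Fin 2 × Fin d, (⨅ i, g i) / 2 ≤ g p.2 / 2 := fun p => by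
      linarith [hmin p.2]
    refine pow_four_mul_sq_le hb hd hnb
      (nonneg_of_mapFeasible hGPOtr hΛ.2 hd hRT.1) (hRT.2 hRTmem) (hR.2 ?_) (hR.2 ?_)
    · rw [thermalOut_eq_realDiag]
      exact div_sub_one_mem_mapFeasible (half_pos hb) hw hΛ
    · have hrt := hRT.1
      rw [mapFeasible_GPO hγ hout hΛ] at hrt
      have := add_div_mem_mapFeasible (half_pos hb) hw hγ hΛ hRS.1
        (thermalOut_eq_realDiag g ▸ hrt)
      rwa [← thermalOut_eq_realDiag] at this
  · rintro rfl
    rw [RT, mapFeasible_GPO hγ hout hΛ]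
    exact (isLeast_opFeasible_LamC_one hd hg_pos hg_sum h0 h1 φ).csInf_eq
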